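/- Let $K$ be a field, $V$ a $K$-vector space with basis $v_1,\dots,v_n$, $G\subset \mathrm{GL}(V)$ a finite subgroup, and $G^*=G\setminus\{1\}$. Let $q_{ij}\in K^*$ and $\kappa(v_i,v_j)=\sum_{g\in G}\kappa_g(v_i,v_j)\,t_g\in KG$ for $1\le i,j\le n$, where $\{t_g\}$ is the standard basis of the group algebra $KG$. Let $F=K\langle v_1,\dots,v_n,\,t_g : g\in G^*\rangle$ be the free associative algebra, where $t_1$ is identified with $1$ and $V$, $KG$ are regarded as subspaces of $F$ in the obvious way. For a subset $W\subseteq V$ put $$R_W=\{t_gt_h-t_{gh}\}_{g,h\in G^*}\cup\{t_gv-g(v)t_g\}_{g\in G^*,\,v\in W}\cup\{v_jv_i-q_{ij}v_iv_j-\kappa(v_i,v_j)\}_{1\le i<j\le n},$$ and let $R=R_V$ and $R_0=R_{\{v_1,\dots,v_n\}}$. Let $\succ$ be a monomial ordering on $F$ (a well-ordering of the words compatible with multiplication on both sides) with $v_1\succ\dots\succ v_n\succ t_g$ for all $g\in G^*$, which preserves the rewriting procedure: $t_gt_h\succ t_{gh}$ for $g,h\in G^*$; $v_jv_i\succ t_g$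 for all $i,j$ and $g\in G^*$; $v_jv_i\succ v_iv_j$ for $i<j$; and $t_gv_i\succ v_jt_g$ for all $i,j$ and $g\in G^*$. A subset $S$ of a two-sided ideal $I$ is a Gröbner basis of $I$ if the leading monomials of the nonzero elements of $S$ generate the same two-sided ideal as those of the nonzero elements of $I$; $S$ is reduced if the leading monomial of each nonzero $s\in S$ is not a subword of any monomial of any other element of $S$. Then $R$ is a Gröbner basis of the two-sided ideal $\langle R\rangle$ with respect to $\succ$ if and only if the following three conditions hold: (i) for all $h\in G$ and $1\le i<j<k\le n$, in $V$, $$0=\bigl(q_{ik}q_{jk}\,h(v_k)-v_k\bigr)\kappa_h(v_i,v_j)+\bigl(q_{jk}v_j-q_{ij}\,h(v_j)\bigr)\kappa_h(v_i,v_k)+\bigl(h(v_i)-q_{ij}q_{ik}v_i\bigr)\kappa_h(v_j,v_k);$$ (ii) for all $g\in G$ and $1\le i<j\le n$, $\;g(v_j)g(v_i)=q_{ij}\,g(v_i)g(v_j)$ in the quantum polynomial algebra $K_Q[V]=K\langle v_1,\dots,v_n\rangle/\langle v_jv_i-q_{ij}v_iv_j: i<j\rangle$; (iii) for all $g,h\in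 G$ and $1\le i<j\le n$, $$\kappa_{h^{-1}gh}(v_i,v_j)=\sum_{k<\ell}\bigl(h^i_kh^j_\ell-q_{ij}h^i_\ell h^j_k\bigr)\,\kappa_g(v_k,v_\ell),\qquad\text{where } h(v_i)=\sum_k h^i_kv_k.$$ Likewise $R_0$ is a Gröbner basis of $\langle R_0\rangle$ if and only if (i)–(iii) hold, and in that case $R_0$ is reduced. -/

import Mathlib

noncomputable section

namespace QDH

/-! ### Monomial orderings and Groebner bases in a free associative algebra -/

/-- The free associative algebra on the alphabet `X`, as the monoid algebra of the free monoid. -/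
abbrev FreeAssoc (K X : Type*) [Field K] : Type _ := MonoidAlgebra K (FreeMonoid X)

/-- `gt u v` means `u ≻ v`: a strict total order on words, compatible with multiplication on both
sides, which is a well-ordering. -/
structure IsMonomialOrder {X : Type*} (gt : FreeMonoid X → FreeMonoid X → Prop) : Prop where
  irrefl : ∀ u, ¬ gt u u
  trans : ∀ u v w, gt u v → gt v w → gt u w
  total : ∀ u v, u ≠ v → gt u v ∨ gt v u
  mul : ∀ a u v b, gt u v → gt (a * u * b) (a * v * b)
  wf : WellFounded fun u v => gt v u

section Groebner

variable {K X : Type*} [Field K]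

/-- `m` is the leading monomial of `f` (in particular `f ≠ 0`). -/
def IsLeadingMonomial (gt : FreeMonoid X → FreeMonoid X → Prop) (f : FreeAssoc K X)
    (m : FreeMonoid X) : Prop :=
  m ∈ f.coeff.support ∧ ∀ w ∈ f.coeff.support, w ≠ m → gt m w

/-- The word `v` divides the word `w`, i.e. `v` is a (contiguous) subword of `w`. -/
def Divides (v w : FreeMonoid X) : Prop := ∃ a b : FreeMonoid X, w = a * v * b

/-- The two-sided ideal generated by the leading monomials of the nonzero elements of `S`. -/
def leadingIdeal (gt : FreeMonoid X → FreeMonoid X → Prop) (S : Set (FreeAssoc K X)) :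
    TwoSidedIdeal (FreeAssoc K X) :=
  TwoSidedIdeal.span {p | ∃ s ∈ S, ∃ m, IsLeadingMonomial gt s m ∧ p = MonoidAlgebra.of K _ m}

/-- `S` is a two-sided Groebner basis of the ideal `I`. -/
def IsGroebnerBasis (gt : FreeMonoid X → FreeMonoid X → Prop) (S : Set (FreeAssoc K X))
    (I : TwoSidedIdeal (FreeAssoc K X)) : Prop :=
  S ⊆ (I : Set (FreeAssoc K X)) ∧
    leadingIdeal gt S = leadingIdeal gt (I : Set (FreeAssoc K X))

/-- `S` is reduced: the leading monomial of `s ∈ S` divides no monomial of any other element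
of `S`. -/
def IsReduced (gt : FreeMonoid X → FreeMonoid X → Prop) (S : Set (FreeAssoc K X)) : Prop :=
  ∀ s ∈ S, ∀ m, IsLeadingMonomial gt s m →
    ∀ f ∈ S, f ≠ s → ∀ w ∈ f.coeff.support, ¬ Divides m w

end Groebner

/-! ### The relations -/

section Relations

variable {K V : Type*} [Field K] [AddCommGroup V] [Module K V] {n : ℕ}

/-- The linear map on `V` given by an element of a subgroup `G ≤ GL(V)`. -/
abbrev act {G : Subgroup (LinearMap.GeneralLinearGroup K V)} (g : G) : V →ₗ[K] V :=
  ((g : LinearMap.GeneralLinearGroup K V) : V →ₗ[K] V)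

/-- The alphabet `v_1, …, v_n, t_g` with `g` a nonidentity element of `G`. -/
abbrev Alphabet (n : ℕ) (G : Subgroup (LinearMap.GeneralLinearGroup K V)) : Type _ :=
  Fin n ⊕ {g : G // g ≠ 1}

variable (G : Subgroup (LinearMap.GeneralLinearGroup K V))

/-- The letter `v_i`, as a word. -/
def vWord (i : Fin n) : FreeMonoid (Alphabet n G) := FreeMonoid.of (Sum.inl i)

variable {G} in
/-- The word of `t_g`: the letter `t_g` for `g ≠ 1`, and the empty word for `g = 1`. -/
def tWord (n : ℕ) (g : G) : FreeMonoid (Alphabet n G) :=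
  open Classical in if h : g = 1 then 1 else FreeMonoid.of (Sum.inr ⟨g, h⟩)

/-- The element `t_g` of the free algebra, where `t_1 = 1`. -/
def tElem (n : ℕ) {G : Subgroup (LinearMap.GeneralLinearGroup K V)} (g : G) :
    FreeAssoc K (Alphabet n G) :=
  MonoidAlgebra.of K _ (tWord n g)

/-- The inclusion of `V` in the free algebra, sending the basis vector `v_i` to the letter
`v_i`. -/
def vecElem (b : Module.Basis (Fin n) K V) (G : Subgroup (LinearMap.GeneralLinearGroup K V)) :
    V →ₗ[K] FreeAssoc K (Alphabet n G) :=
  b.constr K fun i => MonoidAlgebra.of K _ (vWord G i)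

/-- An element `∑ c_g t_g` of the group algebra, viewed in the free algebra. -/
def groupAlgElem (n : ℕ) {G : Subgroup (LinearMap.GeneralLinearGroup K V)}
    (x : MonoidAlgebra K G) : FreeAssoc K (Alphabet n G) :=
  x.coeff.sum fun g c => c • tElem n g

/-- The set of relations `t_g t_h - t_{gh}` (`g, h ≠ 1`), `t_g v - g(v) t_g` (`g ≠ 1`, `v ∈ W`) and
`v_j v_i - q_{ij} v_i v_j - κ(v_i, v_j)` (`i < j`). -/
def relations (b : Module.Basis (Fin n) K V) (q : Fin n → Fin n → K)
    (κ : Fin n → Fin n → MonoidAlgebra K G) (W : Set V) : Set (FreeAssoc K (Alphabet n G)) :=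
  {f | ∃ g h : G, g ≠ 1 ∧ h ≠ 1 ∧ f = tElem n g * tElem n h - tElem n (g * h)} ∪
  {f | ∃ g : G, g ≠ 1 ∧ ∃ v ∈ W,
    f = tElem n g * vecElem b G v - vecElem b G (act g v) * tElem n g} ∪
  {f | ∃ i j : Fin n, i < j ∧
    f = vecElem b G (b j) * vecElem b G (b i) - q i j • (vecElem b G (b i) * vecElem b G (b j))
      - groupAlgElem n (κ i j)}

/-- The ordering satisfies `v_1 ≻ ⋯ ≻ v_n ≻ t_g` and preserves the rewriting procedure. -/
structure PreservesRewriting (gt : FreeMonoid (Alphabet n G) → FreeMonoid (Alphabet n G) → Prop) :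
    Prop where
  v_gt_v : ∀ i j : Fin n, i < j → gt (vWord G i) (vWord G j)
  v_gt_t : ∀ (i : Fin n) (g : G), g ≠ 1 → gt (vWord G i) (tWord n g)
  tt_gt_t : ∀ g h : G, g ≠ 1 → h ≠ 1 → gt (tWord n g * tWord n h) (tWord n (g * h))
  vv_gt_t : ∀ (i j : Fin n) (g : G), g ≠ 1 → gt (vWord G j * vWord G i) (tWord n g)
  vv_gt_vv : ∀ i j : Fin n, i < j → gt (vWord G j * vWord G i) (vWord G i * vWord G j)
  tv_gt_vt : ∀ (i j : Fin n) (g : G), g ≠ 1 →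
    gt (tWord n g * vWord G i) (vWord G j * tWord n g)

/-! ### The quantum polynomial algebra and quantum minors -/

/-- The defining relations `v_j v_i = q_{ij} v_i v_j` for `i < j`. -/
inductive QuantumRel (q : Fin n → Fin n → K) :
    FreeAlgebra K (Fin n) → FreeAlgebra K (Fin n) → Prop
  | swap (i j : Fin n) (hij : i < j) : QuantumRel q
      (FreeAlgebra.ι K j * FreeAlgebra.ι K i) (q i j • (FreeAlgebra.ι K i * FreeAlgebra.ι K j))

/-- The quantum polynomial algebra `K_Q[V]`. -/
abbrev QuantumPoly (q : Fin n → Fin n → K) : Type _ := RingQuot (QuantumRel q)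

/-- The canonical linear map from `V` to the quantum polynomial algebra. -/
def quantumVec (b : Module.Basis (Fin n) K V) (q : Fin n → Fin n → K) : V →ₗ[K] QuantumPoly q :=
  b.constr K fun i => RingQuot.mkAlgHom K (QuantumRel q) (FreeAlgebra.ι K i)

/-- The quantum `(i,j,k,l)`-minor determinant `h^i_k h^j_l - q_{ij} h^i_l h^j_k`, where
`h(v_i) = ∑ k, h^i_k v_k`. -/
def quantumMinor (b : Module.Basis (Fin n) K V) (q : Fin n → Fin n → K) (h : V →ₗ[K] V)
    (i j k l : Fin n) : K :=
  b.repr (h (b i)) k * b.repr (h (b j)) l - q i j * (b.repr (h (b i)) l * b.repr (h (b j)) k)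

end Relations

end QDH

end

noncomputable section

namespace QDH

/-! ### The diamond lemma for rewriting rules with two-letter leading words -/

section QuadraticRewriting

variable {K X : Type*} [Field K]

/-! The relations in `R₀` are rewriting rules whose leading words are the two-letter words t_g t_h,
t_g v_i and v_j v_i (i < j). The normal words, those without such a pair, are v_{i_1} ⋯ v_{i_r} t_g
with i_1 ≤ ⋯ ≤ i_r. By Bergman's diamond lemma it suffices to compare the two rewritings of each
three-letter overlap.

The overlaps t_g t_h t_k and t_g t_h v_i always resolve, because G is associative and acts on V. The
overlap t_g v_j v_i leaves the normal form of g(v_j)g(v_i) - q_{ij} g(v_i)g(v_j), times t_g, plus an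
element of KG; the two parts vanish exactly under (ii) and (iii) (`overlap_tvv`,
`tvv_obstruction_eq_zero_iff`). The overlap v_k v_j v_i leaves ∑ u_h t_h, where u_h is the right
side of (i) (`overlap_vvv`).

If all leftovers vanish, `isGroebnerBasis_of_overlapsResolve` applies. Its core is that two
multiples of relations with the same top word differ by multiples with smaller top words, so
cancelling tops can be pushed down the well-ordering. Conversely, each leftover lies in the ideal
and is a combination of normal words, so it is zero for a Gröbner basis
(`eq_zero_of_isGroebnerBasis`).

Finally, `R` and `R₀` generate the same ideal, because t_g v - g(v) t_g is linear in v, and they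
have the same leading ideal, because each such element with v ≠ 0 is led by some t_g v_i. -/

theorem IsMonomialOrder.mul_left {gt : FreeMonoid X → FreeMonoid X → Prop}
    (hgt : IsMonomialOrder gt) (a : FreeMonoid X) {u v : FreeMonoid X} (h : gt u v) :
    gt (a * u) (a * v) := by
  simpa using hgt.mul a u v 1 h

theorem IsMonomialOrder.mul_right {gt : FreeMonoid X → FreeMonoid X → Prop}
    (hgt : IsMonomialOrder gt) {u v : FreeMonoid X} (h : gt u v) (b : FreeMonoid X) :
    gt (u * b) (v * b) := by
  simpa using hgt.mul 1 u v b h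

/-- If 1 ≻ u, then the powers of u form an infinite descending chain, against the well-ordering. -/
theorem IsMonomialOrder.gt_one {gt : FreeMonoid X → FreeMonoid X → Prop}
    (hgt : IsMonomialOrder gt) {u : FreeMonoid X} (h : u ≠ 1) : gt u 1 := by
  rcases hgt.total u 1 h with h | h
  · exact h
  · exfalso
    have hpow : ∀ k : ℕ, gt (u ^ k) (u ^ (k + 1)) := fun k => by
      simpa [pow_succ] using hgt.mul_left (u ^ k) h
    obtain ⟨m, ⟨k, rfl⟩, hm⟩ := hgt.wf.has_min (Set.range fun k : ℕ => u ^ k) ⟨_, 0, rfl⟩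
    exact hm _ ⟨k + 1, rfl⟩ (hpow k)

/-- Every nonzero element has a leading monomial. -/
theorem exists_isLeadingMonomial {gt : FreeMonoid X → FreeMonoid X → Prop}
    (hgt : IsMonomialOrder gt) {f : FreeAssoc K X} (hf : f ≠ 0) :
    ∃ m, IsLeadingMonomial gt f m := by
  have key : ∀ s : Finset (FreeMonoid X), s.Nonempty → ∃ m ∈ s, ∀ w ∈ s, w ≠ m → gt m w := by
    intro s hs
    induction hs using Finset.Nonempty.cons_induction with
    | singleton a => exact ⟨a, by simp, by simp⟩
    | cons a s has hs ih =>
      obtain ⟨m, hm, hmax⟩ := ih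
      have ham : a ≠ m := fun h => has (h ▸ hm)
      rcases hgt.total a m ham with h | h
      · refine ⟨a, by simp, fun w hw hwa => ?_⟩
        have hws : w ∈ s := (Finset.mem_cons.1 hw).resolve_left hwa
        by_cases hwm : w = m
        · exact hwm ▸ h
        · exact hgt.trans _ _ _ h (hmax w hws hwm)
      · refine ⟨m, by simp [hm], fun w hw hwm => ?_⟩
        rcases Finset.mem_cons.1 hw with rfl | hws
        · exact h
        · exact hmax w hws hwm
  apply key
  simpa [Finsupp.support_nonempty_iff] using hf

/-- The elements of the free algebra supported on the words satisfying `p`. -/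
def suppOn (K : Type*) [Field K] (p : FreeMonoid X → Prop) : Submodule K (FreeAssoc K X) :=
  Submodule.span K (MonoidAlgebra.of K _ '' {v | p v})

theorem of_mem_suppOn {p : FreeMonoid X → Prop} {v : FreeMonoid X} (h : p v) :
    MonoidAlgebra.of K _ v ∈ suppOn K p :=
  Submodule.subset_span ⟨v, h, rfl⟩

theorem suppOn_mono {p q : FreeMonoid X → Prop} (h : ∀ v, p v → q v) : suppOn K p ≤ suppOn K q :=
  Submodule.span_mono (Set.image_mono h)

theorem mul_mem_suppOn {p q r : FreeMonoid X → Prop} {f g : FreeAssoc K X} (hf : f ∈ suppOn K p)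
    (hg : g ∈ suppOn K q) (h : ∀ a b, p a → q b → r (a * b)) : f * g ∈ suppOn K r := by
  have h1 := Submodule.mul_mem_mul hf hg
  rw [suppOn, suppOn, Submodule.span_mul_span] at h1
  refine Submodule.span_mono ?_ h1
  rintro _ ⟨_, ⟨a, ha, rfl⟩, _, ⟨b, hb, rfl⟩, rfl⟩
  exact ⟨a * b, h a b ha hb, map_mul _ _ _⟩

theorem mem_suppOn_iff {p : FreeMonoid X → Prop} {f : FreeAssoc K X} :
    f ∈ suppOn K p ↔ ∀ v ∈ f.coeff.support, p v := by
  classical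
  constructor
  · intro hf
    induction hf using Submodule.span_induction with
    | mem x hx =>
      obtain ⟨v, hv, rfl⟩ := hx
      intro w hw
      have : w = v := by simpa [MonoidAlgebra.of] using hw
      exact this ▸ hv
    | zero => simp
    | add x y _ _ hx hy =>
      intro v hv
      rcases Finset.mem_union.1 (Finsupp.support_add (by simpa using hv)) with h | h
      · exact hx v h
      · exact hy v h
    | smul c x _ hx => exact fun v hv => hx v (by simp_all)
  · intro h
    refine Submodule.span_mono ?_ (MonoidAlgebra.mem_span_support_coeff f)
    exact Set.image_mono fun v hv => h v hv

theorem IsLeadingMonomial.of_add_suppOn {gt : FreeMonoid X → FreeMonoid X → Prop}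
    (hgt : IsMonomialOrder gt) {u : FreeMonoid X} {c : K} (hc : c ≠ 0) {f : FreeAssoc K X}
    (hf : f ∈ suppOn K (gt u)) :
    IsLeadingMonomial gt (c • MonoidAlgebra.of K _ u + f) u := by
  classical
  rw [mem_suppOn_iff] at hf
  have hu : f.coeff u = 0 := by
    by_contra h
    exact hgt.irrefl u (hf u (Finsupp.mem_support_iff.2 h))
  refine ⟨by simp [MonoidAlgebra.of, hu, hc], fun w hw hwu => hf w ?_⟩
  simpa [MonoidAlgebra.of, Finsupp.single_apply, Ne.symm hwu] using hw

/-- A word is normal if it contains no reducible pair of adjacent letters. -/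
def Normal (P : X → X → Prop) (m : FreeMonoid X) : Prop :=
  m.toList.IsChain fun x y => ¬ P x y

theorem not_normal_iff {P : X → X → Prop} {m : FreeMonoid X} :
    ¬ Normal P m ↔ ∃ x y, P x y ∧ Divides (FreeMonoid.of x * FreeMonoid.of y) m := by
  rw [Normal, List.isChain_iff_forall_rel_of_append_cons_cons]
  push Not
  constructor
  · rintro ⟨x, y, a, b, hm, hP⟩
    exact ⟨x, y, hP, FreeMonoid.ofList a, FreeMonoid.ofList b,
      FreeMonoid.toList.injective (by simpa using hm)⟩
  · rintro ⟨x, y, hP, a, b, rfl⟩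
    exact ⟨x, y, a.toList, b.toList, by simp, hP⟩

variable (gt : FreeMonoid X → FreeMonoid X → Prop) (P : X → X → Prop)
  (red : X → X → FreeAssoc K X)

/-- The rewriting relation `x y - red x y`. -/
def quadRel (x y : X) : FreeAssoc K X :=
  MonoidAlgebra.of K _ (FreeMonoid.of x * FreeMonoid.of y) - red x y

/-- The set of all rewriting relations. -/
def quadRels : Set (FreeAssoc K X) := {f | ∃ x y, P x y ∧ f = quadRel red x y}

/-- The span of the multiples `a (x y - red x y) b` for which `a x y b` satisfies `p`. -/
def genSpan (p : FreeMonoid X → Prop) : Submodule K (FreeAssoc K X) :=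
  Submodule.span K {f | ∃ a x y b, P x y ∧ p (a * (FreeMonoid.of x * FreeMonoid.of y) * b) ∧
    f = MonoidAlgebra.of K _ a * quadRel red x y * MonoidAlgebra.of K _ b}

/-- All pairs reduce to combinations of smaller words. -/
def Decreasing : Prop := ∀ x y, P x y → red x y ∈ suppOn K (gt (FreeMonoid.of x * FreeMonoid.of y))

/-- The two ways of rewriting an overlap `x y z` agree, modulo multiples of relations below
`x y z`. -/
def OverlapsResolve : Prop := ∀ x y z, P x y → P y z →
  red x y * MonoidAlgebra.of K _ (FreeMonoid.of z) - MonoidAlgebra.of K _ (FreeMonoid.of x) * red y z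
    ∈ genSpan P red (gt (FreeMonoid.of x * FreeMonoid.of y * FreeMonoid.of z))

variable {gt P red}

/-- Bilinearity in the two outer factors reduces this to words. It allows a rule to be applied
inside arbitrary elements while the top words produced are controlled through supports alone. -/
theorem mul_quadRel_mul_mem_genSpan {p q r : FreeMonoid X → Prop} {f g : FreeAssoc K X} {x y : X}
    (hP : P x y) (hf : f ∈ suppOn K p) (hg : g ∈ suppOn K q)
    (h : ∀ a b, p a → q b → r (a * (FreeMonoid.of x * FreeMonoid.of y) * b)) :
    f * quadRel red x y * g ∈ genSpan P red r := by
  induction hf using Submodule.span_induction with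
  | mem _ hx =>
    obtain ⟨a, ha, rfl⟩ := hx
    induction hg using Submodule.span_induction with
    | mem _ hx =>
      obtain ⟨b, hb, rfl⟩ := hx
      exact Submodule.subset_span ⟨a, x, y, b, hP, h a b ha hb, rfl⟩
    | zero => simp
    | add f g _ _ hf hg => rw [mul_add]; exact add_mem hf hg
    | smul c f _ hf => rw [mul_smul_comm]; exact Submodule.smul_mem _ c hf
  | zero => simp
  | add f g _ _ hf hg => rw [add_mul, add_mul]; exact add_mem hf hg
  | smul c f _ hf => rw [smul_mul_assoc, smul_mul_assoc]; exact Submodule.smul_mem _ c hf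

theorem genSpan_mono {p q : FreeMonoid X → Prop} (h : ∀ v, p v → q v) :
    genSpan P red p ≤ genSpan P red q :=
  Submodule.span_mono fun _ ⟨a, x, y, b, hP, hp, hf⟩ => ⟨a, x, y, b, hP, h _ hp, hf⟩

theorem of_mul_mul_of_mem_genSpan {p q : FreeMonoid X → Prop} {f : FreeAssoc K X}
    (a b : FreeMonoid X) (hf : f ∈ genSpan P red p) (h : ∀ v, p v → q (a * v * b)) :
    MonoidAlgebra.of K _ a * f * MonoidAlgebra.of K _ b ∈ genSpan P red q := by
  induction hf using Submodule.span_induction with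
  | mem _ hx =>
    obtain ⟨c, x, y, d, hP, hp, rfl⟩ := hx
    refine Submodule.subset_span ⟨a * c, x, y, d * b, hP, ?_, ?_⟩
    · simpa [mul_assoc] using h _ hp
    · simp only [map_mul, mul_assoc]
  | zero => simp
  | add f g _ _ hf hg => rw [mul_add, add_mul]; exact add_mem hf hg
  | smul c f _ hf =>
    rw [mul_smul_comm, smul_mul_assoc]; exact Submodule.smul_mem _ c hf

theorem genSpan_le_span (p : FreeMonoid X → Prop) {f : FreeAssoc K X} (hf : f ∈ genSpan P red p) :
    f ∈ TwoSidedIdeal.span (quadRels P red) := by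
  induction hf using Submodule.span_induction with
  | mem _ hx =>
    obtain ⟨c, x, y, d, hP, -, rfl⟩ := hx
    exact TwoSidedIdeal.mul_mem_right _ _ _ (TwoSidedIdeal.mul_mem_left _ _ _
      (TwoSidedIdeal.subset_span ⟨x, y, hP, rfl⟩))
  | zero => exact zero_mem _
  | add f g _ _ hf hg => exact add_mem hf hg
  | smul c f _ hf =>
    rw [← one_mul f, ← smul_mul_assoc]
    exact TwoSidedIdeal.mul_mem_left _ _ _ hf

/-- In (x)(yz - red y z) - (xy - red x y)(z) the cubic word cancels. -/
theorem overlap_mem_span {x y z : X} (hxy : P x y) (hyz : P y z) :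
    red x y * MonoidAlgebra.of K _ (FreeMonoid.of z) -
      MonoidAlgebra.of K _ (FreeMonoid.of x) * red y z ∈
      TwoSidedIdeal.span (quadRels P red) := by
  have h1 := TwoSidedIdeal.mul_mem_left _ (MonoidAlgebra.of K _ (FreeMonoid.of x)) _
    (TwoSidedIdeal.subset_span (s := quadRels P red) ⟨y, z, hyz, rfl⟩)
  have h2 := TwoSidedIdeal.mul_mem_right _ _ (MonoidAlgebra.of K _ (FreeMonoid.of z))
    (TwoSidedIdeal.subset_span (s := quadRels P red) ⟨x, y, hxy, rfl⟩)
  convert sub_mem h1 h2 using 1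
  simp only [quadRel, map_mul, mul_sub, sub_mul, mul_assoc]
  abel

theorem mem_suppOn_true (f : FreeAssoc K X) : f ∈ suppOn K fun _ => True :=
  mem_suppOn_iff.2 fun _ _ => trivial

theorem mul_mem_genSpan_true {f : FreeAssoc K X} (g h : FreeAssoc K X)
    (hf : f ∈ genSpan P red fun _ => True) : g * f * h ∈ genSpan P red fun _ => True := by
  induction hf using Submodule.span_induction with
  | mem _ hx =>
    obtain ⟨c, x, y, d, hP, hp, rfl⟩ := hx
    have := mul_quadRel_mul_mem_genSpan (red := red) (r := fun _ => True) hP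
      (mem_suppOn_true (g * MonoidAlgebra.of K _ c))
      (mem_suppOn_true (MonoidAlgebra.of K _ d * h)) (fun _ _ _ _ => trivial)
    simpa only [mul_assoc] using this
  | zero => simp
  | add f g _ _ hf hg => rw [mul_add, add_mul]; exact add_mem hf hg
  | smul c f _ hf =>
    rw [mul_smul_comm, smul_mul_assoc]; exact Submodule.smul_mem _ c hf

theorem span_le_genSpan {f : FreeAssoc K X} (hf : f ∈ TwoSidedIdeal.span (quadRels P red)) :
    f ∈ genSpan P red fun _ => True := by
  let I : TwoSidedIdeal (FreeAssoc K X) := TwoSidedIdeal.mk'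
    (genSpan P red fun _ => True : Submodule K (FreeAssoc K X))
    (zero_mem _) (fun h h' => add_mem h h') (fun h => neg_mem h)
    (fun {x y} h => by simpa using mul_mem_genSpan_true x 1 h)
    (fun {x y} h => by simpa using mul_mem_genSpan_true 1 y h)
  have hI : TwoSidedIdeal.span (quadRels P red) ≤ I := by
    rw [TwoSidedIdeal.span_le]
    rintro _ ⟨x, y, hP, rfl⟩
    have : quadRel red x y ∈ genSpan P red fun _ => True :=
      Submodule.subset_span ⟨1, x, y, 1, hP, trivial, by rw [map_one, one_mul, mul_one]⟩
    simpa [I] using this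
  simpa [I] using hI hf

theorem genSpan_le_suppOn (hgt : IsMonomialOrder gt) (hdec : Decreasing gt P red)
    (w : FreeMonoid X) : genSpan P red (gt w) ≤ suppOn K (gt w) := by
  rw [genSpan, Submodule.span_le]
  rintro _ ⟨a, x, y, b, hP, hw, rfl⟩
  rw [SetLike.mem_coe, quadRel, mul_sub, sub_mul, ← map_mul, ← map_mul]
  refine sub_mem (of_mem_suppOn hw) ?_
  refine mul_mem_suppOn (mul_mem_suppOn (p := (· = a)) (r := fun v => ∃ u,
    gt (FreeMonoid.of x * FreeMonoid.of y) u ∧ v = a * u) (of_mem_suppOn rfl) (hdec x y hP) ?_)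
    (q := (· = b)) (of_mem_suppOn rfl) ?_
  · rintro _ u rfl hu
    exact ⟨u, hu, rfl⟩
  · rintro _ _ ⟨u, hu, rfl⟩ rfl
    exact hgt.trans _ _ _ hw (hgt.mul _ _ _ _ hu)

/-- Multiples of two relations at the same word, at positions `a` and `a * c`, agree modulo
multiples of relations below this word. -/
theorem quadRel_sub_quadRel_mem_of_le (hgt : IsMonomialOrder gt) (hdec : Decreasing gt P red)
    (hov : OverlapsResolve gt P red) {x y x' y' : X} (hP : P x y) (hP' : P x' y')
    {a b c b' w : FreeMonoid X} (hw : w = a * (FreeMonoid.of x * FreeMonoid.of y) * b)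
    (h : FreeMonoid.of x * FreeMonoid.of y * b = c * (FreeMonoid.of x' * FreeMonoid.of y') * b') :
    MonoidAlgebra.of K _ a * quadRel red x y * MonoidAlgebra.of K _ b -
      MonoidAlgebra.of K _ (a * c) * quadRel red x' y' * MonoidAlgebra.of K _ b'
      ∈ genSpan P red (gt w) := by
  have hl := congrArg FreeMonoid.toList h
  induction c using FreeMonoid.casesOn with
  -- Same position: the two multiples coincide.
  | one =>
    simp only [FreeMonoid.toList_mul, FreeMonoid.toList_of, FreeMonoid.toList_one, List.nil_append,
      List.cons_append, List.cons.injEq] at hl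
    obtain ⟨rfl, rfl, hb⟩ := hl
    obtain rfl : b = b' := FreeMonoid.toList.injective hb
    simp
  | of_mul e c =>
    induction c using FreeMonoid.casesOn with
    -- The pairs share one letter, the second letter of the first pair. The difference is, up to
    -- sign, the overlap expression multiplied by `a` and `b'`.
    | one =>
      simp only [FreeMonoid.toList_mul, FreeMonoid.toList_of, FreeMonoid.toList_one,
        List.nil_append, List.cons_append, List.cons.injEq] at hl
      obtain ⟨rfl, rfl, hb⟩ := hl
      obtain rfl : b = FreeMonoid.of y' * b' := FreeMonoid.toList.injective (by simpa using hb)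
      have h1 := of_mul_mul_of_mem_genSpan (q := gt w) a b' (hov x y y' hP hP') (fun v hv => by
        have := hgt.mul a _ _ b' hv
        rw [hw]
        simpa only [mul_assoc] using this)
      rw [← neg_mem_iff]
      convert h1 using 1
      simp only [quadRel, map_mul, mul_one, mul_sub, sub_mul, mul_assoc]
      abel
    | of_mul e' c =>
      simp only [FreeMonoid.toList_mul, FreeMonoid.toList_of, List.nil_append,
        List.cons_append, List.cons.injEq] at hl
      obtain ⟨rfl, rfl, hb⟩ := hl
      obtain rfl : b = c * (FreeMonoid.of x' * FreeMonoid.of y') * b' :=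
        FreeMonoid.toList.injective (by simpa using hb)
      -- The pairs are disjoint. With r = xy - red and r' = x'y' - red', the identity r c x'y' - xy
      -- c r' = r c red' - red c r' writes the difference as two multiples with top words below `w`.
      have h1 : MonoidAlgebra.of K _ a * quadRel red x y *
          (MonoidAlgebra.of K _ c * red x' y' * MonoidAlgebra.of K _ b') ∈
          genSpan P red (gt w) := by
        refine mul_quadRel_mul_mem_genSpan (p := (· = a)) (q := fun v => ∃ u,
          gt (FreeMonoid.of x' * FreeMonoid.of y') u ∧ v = c * u * b') hP (of_mem_suppOn rfl)
          (mul_mem_suppOn (mul_mem_suppOn (p := (· = c)) (r := fun v => ∃ u,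
            gt (FreeMonoid.of x' * FreeMonoid.of y') u ∧ v = c * u) (of_mem_suppOn rfl)
            (hdec x' y' hP') ?_) (q := (· = b')) (of_mem_suppOn rfl) ?_) ?_
        · rintro _ u rfl hu
          exact ⟨u, hu, rfl⟩
        · rintro _ _ ⟨u, hu, rfl⟩ rfl
          exact ⟨u, hu, rfl⟩
        · rintro _ _ rfl ⟨u, hu, rfl⟩
          rw [hw]
          exact hgt.mul_left _ (hgt.mul _ _ _ _ hu)
      have h2 : MonoidAlgebra.of K _ a * red x y * MonoidAlgebra.of K _ c * quadRel red x' y' *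
          MonoidAlgebra.of K _ b' ∈ genSpan P red (gt w) := by
        refine mul_quadRel_mul_mem_genSpan (q := (· = b')) (p := fun v => ∃ u,
          gt (FreeMonoid.of x * FreeMonoid.of y) u ∧ v = a * u * c) hP'
          (mul_mem_suppOn (mul_mem_suppOn (p := (· = a)) (r := fun v => ∃ u,
            gt (FreeMonoid.of x * FreeMonoid.of y) u ∧ v = a * u) (of_mem_suppOn rfl)
            (hdec x y hP) ?_) (q := (· = c)) (of_mem_suppOn rfl) ?_) (of_mem_suppOn rfl) ?_
        · rintro _ u rfl hu
          exact ⟨u, hu, rfl⟩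
        · rintro _ _ ⟨u, hu, rfl⟩ rfl
          exact ⟨u, hu, rfl⟩
        · rintro _ _ ⟨u, hu, rfl⟩ hd
          rw [hd, hw]
          have := hgt.mul a _ _ (c * (FreeMonoid.of x' * FreeMonoid.of y') * b') hu
          simpa only [mul_assoc] using this
      convert sub_mem h1 h2 using 1
      simp only [quadRel, map_mul, mul_sub, sub_mul, mul_assoc]
      abel

/-- Two factorizations of one word have comparable prefixes, so one pair starts weakly to the left
of the other, and the difference is antisymmetric. -/
theorem quadRel_sub_quadRel_mem (hgt : IsMonomialOrder gt) (hdec : Decreasing gt P red)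
    (hov : OverlapsResolve gt P red) {x y x' y' : X} (hP : P x y) (hP' : P x' y')
    {a b a' b' w : FreeMonoid X} (hw : w = a * (FreeMonoid.of x * FreeMonoid.of y) * b)
    (hw' : w = a' * (FreeMonoid.of x' * FreeMonoid.of y') * b') :
    MonoidAlgebra.of K _ a * quadRel red x y * MonoidAlgebra.of K _ b -
      MonoidAlgebra.of K _ a' * quadRel red x' y' * MonoidAlgebra.of K _ b'
      ∈ genSpan P red (gt w) := by
  have hl : a.toList ++ ((FreeMonoid.of x * FreeMonoid.of y) * b).toList =
      a'.toList ++ ((FreeMonoid.of x' * FreeMonoid.of y') * b').toList := by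
    rw [← FreeMonoid.toList_mul, ← FreeMonoid.toList_mul, ← mul_assoc a, ← mul_assoc a', ← hw, ← hw']
  rcases List.append_eq_append_iff.1 hl with ⟨c, h1, h2⟩ | ⟨c, h1, h2⟩
  · obtain rfl : a' = a * FreeMonoid.ofList c := FreeMonoid.toList.injective h1
    refine quadRel_sub_quadRel_mem_of_le hgt hdec hov hP hP' hw (FreeMonoid.toList.injective ?_)
    rw [h2]
    simp
  · obtain rfl : a = a' * FreeMonoid.ofList c := FreeMonoid.toList.injective h1
    rw [← neg_mem_iff, neg_sub]
    refine quadRel_sub_quadRel_mem_of_le hgt hdec hov hP' hP hw' (FreeMonoid.toList.injective ?_)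
    rw [h2]
    simp

/-- An element of `genSpan` is zero, or has a top multiple of a relation. -/
theorem eq_zero_or_exists_top (hgt : IsMonomialOrder gt) (hdec : Decreasing gt P red)
    (hov : OverlapsResolve gt P red) {p : FreeMonoid X → Prop} {f : FreeAssoc K X}
    (hf : f ∈ genSpan P red p) :
    f = 0 ∨ ∃ a x y b, P x y ∧ p (a * (FreeMonoid.of x * FreeMonoid.of y) * b) ∧
      ∃ c : K, f - c • (MonoidAlgebra.of K _ a * quadRel red x y * MonoidAlgebra.of K _ b) ∈
        genSpan P red (gt (a * (FreeMonoid.of x * FreeMonoid.of y) * b)) := by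
  induction hf using Submodule.span_induction with
  | mem _ hx =>
    obtain ⟨a, x, y, b, hP, hp, rfl⟩ := hx
    exact Or.inr ⟨a, x, y, b, hP, hp, 1, by simp⟩
  | zero => exact Or.inl rfl
  | add f g _ _ hf hg =>
    rcases hf with rfl | ⟨a, x, y, b, hP, hp, c, hc⟩
    · simpa using hg
    rcases hg with rfl | ⟨a', x', y', b', hP', hp', c', hc'⟩
    · exact Or.inr ⟨a, x, y, b, hP, hp, c, by simpa using hc⟩
    right
    set u := a * (FreeMonoid.of x * FreeMonoid.of y) * b with hu
    set u' := a' * (FreeMonoid.of x' * FreeMonoid.of y') * b' with hu'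
    by_cases heq : u = u'
    -- The sum `c + c'` may be zero: the top coefficient is not required to survive.
    · refine ⟨a, x, y, b, hP, hp, c + c', ?_⟩
      rw [← heq] at hc'
      have h1 := Submodule.smul_mem _ c'
        (quadRel_sub_quadRel_mem hgt hdec hov hP hP' hu (heq.trans hu'))
      rw [← hu]
      convert sub_mem (add_mem hc hc') h1 using 1
      rw [add_smul, smul_sub]
      abel
    · rcases hgt.total u u' heq with h | h
      · refine ⟨a, x, y, b, hP, hp, c, ?_⟩
        rw [← hu]
        have h1 := genSpan_mono (fun v => hgt.trans u u' v h) hc'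
        have h2 : MonoidAlgebra.of K _ a' * quadRel red x' y' * MonoidAlgebra.of K _ b' ∈
            genSpan P red (gt u) := Submodule.subset_span ⟨a', x', y', b', hP', h, rfl⟩
        convert add_mem hc (add_mem h1 (Submodule.smul_mem _ c' h2)) using 1
        abel
      · refine ⟨a', x', y', b', hP', hp', c', ?_⟩
        rw [← hu']
        have h1 := genSpan_mono (fun v => hgt.trans u' u v h) hc
        have h2 : MonoidAlgebra.of K _ a * quadRel red x y * MonoidAlgebra.of K _ b ∈
            genSpan P red (gt u') := Submodule.subset_span ⟨a, x, y, b, hP, h, rfl⟩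
        convert add_mem hc' (add_mem h1 (Submodule.smul_mem _ c h2)) using 1
        abel
  | smul d f _ hf =>
    rcases hf with rfl | ⟨a, x, y, b, hP, hp, c, hc⟩
    · simp
    · refine Or.inr ⟨a, x, y, b, hP, hp, d * c, ?_⟩
      rw [mul_smul, ← smul_sub]
      exact Submodule.smul_mem _ d hc

/-- Inductive step of the diamond lemma: the leading monomial of a nonzero element of `genSpan P red p`
is reducible if this holds below every word satisfying `p`. -/
theorem exists_isLeadingMonomial_not_normal (hgt : IsMonomialOrder gt)
    (hdec : Decreasing gt P red) (hov : OverlapsResolve gt P red) (p : FreeMonoid X → Prop)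
    (hp : ∀ v, p v → ∀ f : FreeAssoc K X, f ∈ genSpan P red (gt v) → f ≠ 0 →
      ∃ m, IsLeadingMonomial gt f m ∧ ¬ Normal P m)
    {f : FreeAssoc K X} (hf : f ∈ genSpan P red p) (hf0 : f ≠ 0) :
    ∃ m, IsLeadingMonomial gt f m ∧ ¬ Normal P m := by
  rcases eq_zero_or_exists_top hgt hdec hov hf with h | ⟨a, x, y, b, hP, hpu, c, hc⟩
  · exact absurd h hf0
  -- If the top cancels, `f` already lies below that word and `hp` takes over; otherwise the
  -- reducible top word is the leading monomial.
  by_cases hc0 : c = 0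
  · rw [hc0, zero_smul, sub_zero] at hc
    exact hp _ hpu f hc hf0
  · refine ⟨_, ?_, not_normal_iff.2 ⟨x, y, hP, a, b, rfl⟩⟩
    have h1 := genSpan_le_suppOn hgt hdec _ hc
    have h2 : c • (MonoidAlgebra.of K _ a * red x y * MonoidAlgebra.of K _ b) ∈
        suppOn K (gt (a * (FreeMonoid.of x * FreeMonoid.of y) * b)) := by
      refine Submodule.smul_mem _ _ (mul_mem_suppOn (mul_mem_suppOn (p := (· = a))
        (r := fun v => ∃ u, gt (FreeMonoid.of x * FreeMonoid.of y) u ∧ v = a * u)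
        (of_mem_suppOn rfl) (hdec x y hP) ?_) (q := (· = b)) (of_mem_suppOn rfl) ?_)
      · rintro _ u rfl hu
        exact ⟨u, hu, rfl⟩
      · rintro _ _ ⟨u, hu, rfl⟩ rfl
        exact hgt.mul _ _ _ _ hu
    convert IsLeadingMonomial.of_add_suppOn hgt hc0 (sub_mem h1 h2) using 1
    simp only [quadRel, map_mul, mul_sub, sub_mul, smul_sub, mul_assoc]
    abel

theorem isLeadingMonomial_unique (hgt : IsMonomialOrder gt) {f : FreeAssoc K X} {m m' : FreeMonoid X}
    (h : IsLeadingMonomial gt f m) (h' : IsLeadingMonomial gt f m') : m = m' := by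
  by_contra hne
  exact hgt.irrefl _ (hgt.trans _ _ _ (h.2 m' h'.1 (Ne.symm hne)) (h'.2 m h.1 hne))

theorem isLeadingMonomial_quadRel (hgt : IsMonomialOrder gt) (hdec : Decreasing gt P red) {x y : X}
    (hP : P x y) :
    IsLeadingMonomial gt (quadRel red x y) (FreeMonoid.of x * FreeMonoid.of y) := by
  have := IsLeadingMonomial.of_add_suppOn hgt (one_ne_zero (α := K)) (neg_mem (hdec x y hP))
  rwa [one_smul, ← sub_eq_add_neg] at this

/-- Words in the support of an element of the leading ideal of the relations are reducible. -/
theorem not_normal_of_mem_leadingIdeal (hgt : IsMonomialOrder gt) (hdec : Decreasing gt P red)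
    {f : FreeAssoc K X} (hf : f ∈ leadingIdeal gt (quadRels P red)) :
    f ∈ suppOn K fun m => ¬ Normal P m := by
  have hmul : ∀ a f b : FreeAssoc K X, f ∈ (suppOn K fun m => ¬ Normal P m) →
      a * f * b ∈ suppOn K fun m => ¬ Normal P m := by
    intro a f b hf
    refine mul_mem_suppOn (mul_mem_suppOn (mem_suppOn_true a) hf (r := fun m => ¬ Normal P m) ?_)
      (mem_suppOn_true b) ?_
    · intro a m _ hm
      obtain ⟨x, y, hP, c, d, rfl⟩ := not_normal_iff.1 hm
      exact not_normal_iff.2 ⟨x, y, hP, a * c, d, by simp only [mul_assoc]⟩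
    · intro m b hm _
      obtain ⟨x, y, hP, c, d, rfl⟩ := not_normal_iff.1 hm
      exact not_normal_iff.2 ⟨x, y, hP, c, d * b, by simp only [mul_assoc]⟩
  let I : TwoSidedIdeal (FreeAssoc K X) := TwoSidedIdeal.mk'
    (suppOn K fun m => ¬ Normal P m : Submodule K (FreeAssoc K X))
    (zero_mem _) (fun h h' => add_mem h h') (fun h => neg_mem h)
    (fun {x y} h => by simpa using hmul x y 1 h)
    (fun {x y} h => by simpa using hmul 1 x y h)
  have hI : leadingIdeal gt (quadRels P red) ≤ I := by
    rw [leadingIdeal, TwoSidedIdeal.span_le]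
    rintro _ ⟨_, ⟨x, y, hP, rfl⟩, m, hm, rfl⟩
    obtain rfl := isLeadingMonomial_unique hgt hm (isLeadingMonomial_quadRel hgt hdec hP)
    have : MonoidAlgebra.of K _ (FreeMonoid.of x * FreeMonoid.of y) ∈
        suppOn K fun m => ¬ Normal P m :=
      of_mem_suppOn (not_normal_iff.2 ⟨x, y, hP, 1, 1, by simp⟩)
    rw [SetLike.mem_coe, TwoSidedIdeal.mem_mk']
    exact this
  have := hI hf
  rwa [TwoSidedIdeal.mem_mk'] at this

/-- The leading words of the relations are exactly the reducible pairs, so a word lies in their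
leading ideal precisely when it is not normal. -/
theorem isGroebnerBasis_iff (hgt : IsMonomialOrder gt) (hdec : Decreasing gt P red) :
    IsGroebnerBasis gt (quadRels P red) (TwoSidedIdeal.span (quadRels P red)) ↔
      ∀ f ∈ TwoSidedIdeal.span (quadRels P red), f ≠ 0 →
        ∃ m, IsLeadingMonomial gt f m ∧ ¬ Normal P m := by
  constructor
  · rintro ⟨-, h⟩ f hf hf0
    obtain ⟨m, hm⟩ := exists_isLeadingMonomial hgt hf0
    refine ⟨m, hm, ?_⟩
    have h1 : MonoidAlgebra.of K _ m ∈ leadingIdeal gt (quadRels P red) := by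
      rw [h]
      exact TwoSidedIdeal.subset_span ⟨f, hf, m, hm, rfl⟩
    exact mem_suppOn_iff.1 (not_normal_of_mem_leadingIdeal hgt hdec h1) m
      (by simp [MonoidAlgebra.of])
  · intro h
    refine ⟨TwoSidedIdeal.subset_span, le_antisymm ?_ ?_⟩
    · refine TwoSidedIdeal.span_mono ?_
      rintro _ ⟨s, hs, m, hm, rfl⟩
      exact ⟨s, TwoSidedIdeal.subset_span hs, m, hm, rfl⟩
    · rw [leadingIdeal, TwoSidedIdeal.span_le]
      rintro _ ⟨f, hf, m, hm, rfl⟩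
      have hf0 : f ≠ 0 := by
        rintro rfl
        simpa using hm.1
      obtain ⟨m', hm', hn⟩ := h f hf hf0
      obtain rfl := isLeadingMonomial_unique hgt hm hm'
      obtain ⟨x, y, hP, a, b, rfl⟩ := not_normal_iff.1 hn
      rw [map_mul, map_mul]
      exact TwoSidedIdeal.mul_mem_right _ _ _ (TwoSidedIdeal.mul_mem_left _ _ _
        (TwoSidedIdeal.subset_span ⟨_, ⟨x, y, hP, rfl⟩, _,
          isLeadingMonomial_quadRel hgt hdec hP, rfl⟩))

/-- The diamond lemma: if all overlaps resolve, the relations form a Groebner basis. -/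
theorem isGroebnerBasis_of_overlapsResolve (hgt : IsMonomialOrder gt)
    (hdec : Decreasing gt P red) (hov : OverlapsResolve gt P red) :
    IsGroebnerBasis gt (quadRels P red) (TwoSidedIdeal.span (quadRels P red)) := by
  refine (isGroebnerBasis_iff hgt hdec).2 fun f hf hf0 => ?_
  -- The ideal is `genSpan` with no bound on the top words. The claim below a given word `v` follows
  -- by well-founded induction, using the same step.
  refine exists_isLeadingMonomial_not_normal hgt hdec hov _ (fun v _ => ?_)
    (span_le_genSpan hf) hf0
  induction v using hgt.wf.induction with
  | _ v ih =>
    exact fun f hf hf0 => exists_isLeadingMonomial_not_normal hgt hdec hov _ ih hf hf0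

/-- Uniqueness of normal forms, which drives the necessity of (i)–(iii). -/
theorem eq_zero_of_isGroebnerBasis (hgt : IsMonomialOrder gt) (hdec : Decreasing gt P red)
    (h : IsGroebnerBasis gt (quadRels P red) (TwoSidedIdeal.span (quadRels P red)))
    {f : FreeAssoc K X} (hf : f ∈ TwoSidedIdeal.span (quadRels P red))
    (hn : f ∈ suppOn K (Normal P)) : f = 0 := by
  by_contra hf0
  obtain ⟨m, hm, hm'⟩ := (isGroebnerBasis_iff hgt hdec).1 h f hf hf0
  exact hm' (mem_suppOn_iff.1 hn m hm.1)

end QuadraticRewriting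

/-! ### The relations as a rewriting system on the letters v_i and t_g -/

section DrinfeldRelations

variable {K V : Type*} [Field K] [AddCommGroup V] [Module K V] {n : ℕ}
  {G : Subgroup (LinearMap.GeneralLinearGroup K V)}

/-- The reducible pairs of letters: `t_g t_h`, `t_g v_i`, and `v_j v_i` for `i < j`. -/
def Reducible : Alphabet n G → Alphabet n G → Prop
  | Sum.inr _, Sum.inr _ => True
  | Sum.inr _, Sum.inl _ => True
  | Sum.inl j, Sum.inl i => i < j
  | Sum.inl _, Sum.inr _ => False

/-- The reduction of a reducible pair of letters. -/
def reduction (b : Module.Basis (Fin n) K V) (q : Fin n → Fin n → K)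
    (κ : Fin n → Fin n → MonoidAlgebra K G) :
    Alphabet n G → Alphabet n G → FreeAssoc K (Alphabet n G)
  | Sum.inr g, Sum.inr h => tElem n (g.1 * h.1)
  | Sum.inr g, Sum.inl i => vecElem b G (act g.1 (b i)) * tElem n g.1
  | Sum.inl j, Sum.inl i =>
    q i j • MonoidAlgebra.of K _ (vWord G i * vWord G j) + groupAlgElem n (κ i j)
  | Sum.inl _, Sum.inr _ => 0

theorem tWord_one : tWord n (1 : G) = 1 := by simp [tWord]

theorem tElem_one : tElem n (1 : G) = 1 := by rw [tElem, tWord_one, map_one]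

theorem tWord_of_ne_one {g : G} (hg : g ≠ 1) :
    tWord n g = FreeMonoid.of (Sum.inr ⟨g, hg⟩) := by simp [tWord, hg]

theorem vecElem_basis (b : Module.Basis (Fin n) K V) (i : Fin n) :
    vecElem b G (b i) = MonoidAlgebra.of K _ (vWord G i) := by
  rw [vecElem, Module.Basis.constr_basis]

theorem relations_range_eq (b : Module.Basis (Fin n) K V) (q : Fin n → Fin n → K)
    (κ : Fin n → Fin n → MonoidAlgebra K G) :
    relations G b q κ (Set.range b) = quadRels Reducible (reduction b q κ) := by
  ext f
  constructor
  · rintro ((⟨g, h, hg, hh, rfl⟩ | ⟨g, hg, _, ⟨i, rfl⟩, rfl⟩) | ⟨i, j, hij, rfl⟩)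
    · refine ⟨Sum.inr ⟨g, hg⟩, Sum.inr ⟨h, hh⟩, trivial, ?_⟩
      rw [quadRel, ← tWord_of_ne_one, ← tWord_of_ne_one, map_mul]
      rfl
    · refine ⟨Sum.inr ⟨g, hg⟩, Sum.inl i, trivial, ?_⟩
      rw [quadRel, ← tWord_of_ne_one, map_mul, vecElem_basis]
      rfl
    · refine ⟨Sum.inl j, Sum.inl i, hij, ?_⟩
      rw [quadRel, reduction, map_mul, map_mul, vecElem_basis, vecElem_basis, sub_sub]
      rfl
  · rintro ⟨⟨j⟩ | ⟨g, hg⟩, ⟨i⟩ | ⟨h, hh⟩, hP, rfl⟩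
    · refine Or.inr ⟨i, j, hP, ?_⟩
      rw [quadRel, reduction, map_mul, map_mul, vecElem_basis, vecElem_basis, sub_sub]
      rfl
    · exact hP.elim
    · refine Or.inl (Or.inr ⟨g, hg, b i, ⟨i, rfl⟩, ?_⟩)
      rw [quadRel, ← tWord_of_ne_one, map_mul, vecElem_basis]
      rfl
    · refine Or.inl (Or.inl ⟨g, h, hg, hh, ?_⟩)
      rw [quadRel, ← tWord_of_ne_one, ← tWord_of_ne_one, map_mul]
      rfl

/-- The inclusion of the group algebra in the free algebra, as a linear map. -/
def groupAlgLin (n : ℕ) (G : Subgroup (LinearMap.GeneralLinearGroup K V)) :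
    MonoidAlgebra K G →ₗ[K] FreeAssoc K (Alphabet n G) :=
  Finsupp.linearCombination K (tElem n) ∘ₗ (MonoidAlgebra.coeffLinearEquiv K).toLinearMap

theorem groupAlgElem_eq (x : MonoidAlgebra K G) : groupAlgElem n x = groupAlgLin n G x := rfl

theorem groupAlgLin_single (g : G) (c : K) :
    groupAlgLin n G (MonoidAlgebra.single g c) = c • tElem n g := by
  rw [← groupAlgElem_eq, groupAlgElem]
  simp

theorem groupAlgLin_eq_sum [Fintype G] (x : MonoidAlgebra K G) :
    groupAlgLin n G x = ∑ g, x.coeff g • tElem n g := by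
  rw [← groupAlgElem_eq, groupAlgElem, Finsupp.sum_fintype]
  simp

theorem tElem_mem_suppOn (g : G) : tElem n g ∈ suppOn K (· = tWord n g) := of_mem_suppOn rfl

theorem groupAlgLin_mem_suppOn (x : MonoidAlgebra K G) :
    groupAlgLin n G x ∈ suppOn K fun w => ∃ g : G, w = tWord n g := by
  induction x using MonoidAlgebra.induction_linear with
  | zero => simp
  | add x y hx hy => rw [map_add]; exact add_mem hx hy
  | single g c =>
    rw [groupAlgLin_single]
    exact Submodule.smul_mem _ _ (of_mem_suppOn ⟨g, rfl⟩)

theorem vecElem_mem_suppOn (b : Module.Basis (Fin n) K V) (v : V) :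
    vecElem b G v ∈ suppOn K fun w => ∃ i, w = vWord G i := by
  rw [vecElem, Module.Basis.constr_apply_fintype]
  exact Submodule.sum_mem _ fun i _ => Submodule.smul_mem _ _ (of_mem_suppOn ⟨i, rfl⟩)

theorem PreservesRewriting.vv_gt_tWord
    {gt : FreeMonoid (Alphabet n G) → FreeMonoid (Alphabet n G) → Prop}
    (hpres : PreservesRewriting G gt) (hgt : IsMonomialOrder gt) (i j : Fin n) (g : G) :
    gt (vWord G j * vWord G i) (tWord n g) := by
  -- The hypotheses on the order speak of g ≠ 1 only; the word of t_1 is empty, and 1 is the least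
  -- word.
  by_cases hg : g = 1
  · subst hg
    rw [tWord_one]
    apply hgt.gt_one
    intro h
    simpa [vWord] using congrArg FreeMonoid.length h
  · exact hpres.vv_gt_t i j g hg

theorem decreasing_reduction {gt : FreeMonoid (Alphabet n G) → FreeMonoid (Alphabet n G) → Prop}
    (hgt : IsMonomialOrder gt) (hpres : PreservesRewriting G gt)
    (b : Module.Basis (Fin n) K V) (q : Fin n → Fin n → K)
    (κ : Fin n → Fin n → MonoidAlgebra K G) :
    Decreasing gt Reducible (reduction b q κ) := by
  rintro (j | ⟨g, hg⟩) (i | ⟨h, hh⟩) hP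
  · refine add_mem (Submodule.smul_mem _ _ (of_mem_suppOn (hpres.vv_gt_vv i j hP))) ?_
    refine suppOn_mono ?_ (groupAlgLin_mem_suppOn _)
    rintro _ ⟨g, rfl⟩
    exact hpres.vv_gt_tWord hgt i j g
  · exact hP.elim
  · refine mul_mem_suppOn (vecElem_mem_suppOn b _) (tElem_mem_suppOn _) ?_
    rintro _ _ ⟨j, rfl⟩ rfl
    rw [← tWord_of_ne_one]
    exact hpres.tv_gt_vt i j g hg
  · refine of_mem_suppOn ?_
    rw [← tWord_of_ne_one, ← tWord_of_ne_one]
    exact hpres.tt_gt_t g h hg hh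

/-! ### Normal words -/

theorem normal_tWord (g : G) : Normal Reducible (tWord n g) := by
  by_cases hg : g = 1
  · subst hg
    simp [Normal, tWord_one]
  · simp [Normal, tWord_of_ne_one hg]

theorem normal_v_t (i : Fin n) (g : G) : Normal Reducible (vWord G i * tWord n g) := by
  by_cases hg : g = 1
  · subst hg
    simp [Normal, tWord_one, vWord]
  · simp [Normal, tWord_of_ne_one hg, vWord, Reducible]

theorem normal_v_v_t {i j : Fin n} (hij : i ≤ j) (g : G) :
    Normal Reducible (vWord G i * vWord G j * tWord n g) := by
  by_cases hg : g = 1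
  · subst hg
    simp [Normal, tWord_one, vWord, Reducible, hij]
  · simp [Normal, tWord_of_ne_one hg, vWord, Reducible, hij]

theorem reduction_mem_suppOn_normal (b : Module.Basis (Fin n) K V) (q : Fin n → Fin n → K)
    (κ : Fin n → Fin n → MonoidAlgebra K G) {x y : Alphabet n G} (hP : Reducible x y) :
    reduction b q κ x y ∈ suppOn K (Normal Reducible) := by
  rcases x with j | ⟨g, hg⟩ <;> rcases y with i | ⟨h, hh⟩
  · refine add_mem (Submodule.smul_mem _ _ (of_mem_suppOn ?_)) ?_
    · simpa [tWord_one] using normal_v_v_t (le_of_lt hP) (1 : G)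
    · refine suppOn_mono ?_ (groupAlgLin_mem_suppOn _)
      rintro _ ⟨g, rfl⟩
      exact normal_tWord g
  · exact hP.elim
  · refine mul_mem_suppOn (vecElem_mem_suppOn b _) (tElem_mem_suppOn _) ?_
    rintro _ _ ⟨j, rfl⟩ rfl
    exact normal_v_t j g
  · exact of_mem_suppOn (normal_tWord _)

/-- The tail of each relation consists of normal words, so a leading pair can divide only the
leading pair of another relation. Both have length two, so they are equal, and the pair determines
the relation. -/
theorem isReduced_relations {gt : FreeMonoid (Alphabet n G) → FreeMonoid (Alphabet n G) → Prop}
    (hgt : IsMonomialOrder gt) (hpres : PreservesRewriting G gt)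
    (b : Module.Basis (Fin n) K V) (q : Fin n → Fin n → K)
    (κ : Fin n → Fin n → MonoidAlgebra K G) :
    IsReduced gt (relations G b q κ (Set.range b)) := by
  classical
  rw [relations_range_eq]
  rintro _ ⟨x, y, hP, rfl⟩ m hm _ ⟨x', y', hP', rfl⟩ hne w hw hdiv
  obtain rfl := isLeadingMonomial_unique hgt hm
    (isLeadingMonomial_quadRel hgt (decreasing_reduction hgt hpres b q κ) hP)
  have hwn : ¬ Normal Reducible w := not_normal_iff.2 ⟨x, y, hP, hdiv⟩
  have hw' : quadRel (reduction b q κ) x' y' ∈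
      suppOn K fun u => u = FreeMonoid.of x' * FreeMonoid.of y' ∨ Normal Reducible u :=
    sub_mem (of_mem_suppOn (Or.inl rfl))
      (suppOn_mono (fun _ => Or.inr) (reduction_mem_suppOn_normal b q κ hP'))
  rcases mem_suppOn_iff.1 hw' w hw with rfl | h
  · obtain ⟨a, c, h⟩ := hdiv
    have hlen := congrArg FreeMonoid.length h
    simp only [FreeMonoid.length_mul, FreeMonoid.length_of] at hlen
    obtain rfl : a = 1 := FreeMonoid.length_eq_zero.1 (by omega)
    obtain rfl : c = 1 := FreeMonoid.length_eq_zero.1 (by omega)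
    have hl := congrArg FreeMonoid.toList h
    simp at hl
    exact hne (by rw [hl.1, hl.2])
  · exact hwn h

/-! ### All vectors versus basis vectors -/

theorem tElem_mul_vecElem_sub_mem (b : Module.Basis (Fin n) K V) (q : Fin n → Fin n → K)
    (κ : Fin n → Fin n → MonoidAlgebra K G) {g : G} (hg : g ≠ 1) (v : V) :
    tElem n g * vecElem b G v - vecElem b G (act g v) * tElem n g ∈
      TwoSidedIdeal.span (relations G b q κ (Set.range b)) := by
  rw [relations_range_eq]
  -- Passing to `genSpan` turns the ideal into a K-subspace, where linearity in `v` can be used.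
  refine genSpan_le_span (fun _ => True) ?_
  have hv := b.mem_span v
  induction hv using Submodule.span_induction with
  | mem _ h =>
    obtain ⟨i, rfl⟩ := h
    apply span_le_genSpan
    rw [← relations_range_eq]
    exact TwoSidedIdeal.subset_span (Or.inl (Or.inr ⟨g, hg, b i, ⟨i, rfl⟩, rfl⟩))
  | zero => simp
  | add u v _ _ hu hv =>
    convert add_mem hu hv using 1
    simp only [map_add, mul_add, add_mul]
    abel
  | smul c v _ hv =>
    convert Submodule.smul_mem _ c hv using 1
    simp only [map_smul, mul_smul_comm, smul_mul_assoc, smul_sub]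

theorem span_relations_univ (b : Module.Basis (Fin n) K V) (q : Fin n → Fin n → K)
    (κ : Fin n → Fin n → MonoidAlgebra K G) :
    TwoSidedIdeal.span (relations G b q κ Set.univ) =
      TwoSidedIdeal.span (relations G b q κ (Set.range b)) := by
  apply le_antisymm
  · rw [TwoSidedIdeal.span_le]
    rintro f ((h | ⟨g, hg, v, -, rfl⟩) | h)
    · exact TwoSidedIdeal.subset_span (Or.inl (Or.inl h))
    · exact tElem_mul_vecElem_sub_mem b q κ hg v
    · exact TwoSidedIdeal.subset_span (Or.inr h)
  · apply TwoSidedIdeal.span_mono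
    rintro f ((h | ⟨g, hg, v, -, rfl⟩) | h)
    · exact Or.inl (Or.inl h)
    · exact Or.inl (Or.inr ⟨g, hg, v, trivial, rfl⟩)
    · exact Or.inr h

theorem coeff_vecElem (b : Module.Basis (Fin n) K V) (v : V) (i : Fin n) :
    (vecElem b G v).coeff (vWord G i) = b.repr v i := by
  classical
  rw [vecElem, Module.Basis.constr_apply_fintype]
  simp [MonoidAlgebra.of, vWord, Finsupp.single_apply, FreeMonoid.of_injective.eq_iff]

/-- If v ≠ 0, then some t_g v_i occurs with the coordinate of v as coefficient. It cannot cancel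
against words starting with a v, and it exceeds every v_j t_g. -/
theorem exists_eq_of_isLeadingMonomial_tv
    {gt : FreeMonoid (Alphabet n G) → FreeMonoid (Alphabet n G) → Prop}
    (hgt : IsMonomialOrder gt) (hpres : PreservesRewriting G gt)
    (b : Module.Basis (Fin n) K V) {g : G} (hg : g ≠ 1) {v : V} {m : FreeMonoid (Alphabet n G)}
    (hm : IsLeadingMonomial gt
      (tElem n g * vecElem b G v - vecElem b G (act g v) * tElem n g) m) :
    ∃ i, m = tWord n g * vWord G i := by
  have h1 : tElem n g * vecElem b G v ∈ suppOn K fun w => ∃ i, w = tWord n g * vWord G i := by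
    refine mul_mem_suppOn (tElem_mem_suppOn g) (vecElem_mem_suppOn b v) ?_
    rintro _ _ rfl ⟨i, rfl⟩
    exact ⟨i, rfl⟩
  have h2 : vecElem b G (act g v) * tElem n g ∈
      suppOn K fun w => ∃ i, w = vWord G i * tWord n g := by
    refine mul_mem_suppOn (vecElem_mem_suppOn b _) (tElem_mem_suppOn g) ?_
    rintro _ _ ⟨i, rfl⟩ rfl
    exact ⟨i, rfl⟩
  have h3 := sub_mem (suppOn_mono (q := fun w => (∃ i, w = tWord n g * vWord G i) ∨
    ∃ i, w = vWord G i * tWord n g) (fun _ => Or.inl) h1) (suppOn_mono (fun _ => Or.inr) h2)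
  rcases mem_suppOn_iff.1 h3 m hm.1 with h | ⟨j, rfl⟩
  · exact h
  exfalso
  by_cases hv : v = 0
  · subst hv
    simpa using hm.1
  obtain ⟨i, hi⟩ : ∃ i, b.repr v i ≠ 0 := by
    by_contra! h
    exact hv (b.repr.map_eq_zero_iff.1 (Finsupp.ext h))
  have hne : ∀ k : Fin n, tWord n g * vWord G i ≠ vWord G k * tWord n g := by
    intro k h
    have := congrArg FreeMonoid.toList h
    simp [tWord_of_ne_one hg, vWord] at this
  have hmem : tWord n g * vWord G i ∈
      (tElem n g * vecElem b G v - vecElem b G (act g v) * tElem n g).coeff.support := by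
    have h4 : (vecElem b G (act g v) * tElem n g).coeff (tWord n g * vWord G i) = 0 := by
      by_contra h
      obtain ⟨k, hk⟩ := mem_suppOn_iff.1 h2 _ (Finsupp.mem_support_iff.2 h)
      exact hne k hk
    have h5 : (tElem n g * vecElem b G v).coeff (tWord n g * vWord G i) = b.repr v i := by
      rw [tElem, MonoidAlgebra.of_apply, MonoidAlgebra.coeff_single_mul_eq_mul_coeff (vWord G i),
        one_mul, coeff_vecElem]
      simp
    rw [Finsupp.mem_support_iff, MonoidAlgebra.coeff_sub, Finsupp.sub_apply, h4, h5, sub_zero]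
    exact hi
  exact hgt.irrefl _ (hgt.trans _ _ _ (hm.2 _ hmem (hne j)) (hpres.tv_gt_vt i j g hg))

theorem leadingIdeal_relations_univ
    {gt : FreeMonoid (Alphabet n G) → FreeMonoid (Alphabet n G) → Prop}
    (hgt : IsMonomialOrder gt) (hpres : PreservesRewriting G gt)
    (b : Module.Basis (Fin n) K V) (q : Fin n → Fin n → K)
    (κ : Fin n → Fin n → MonoidAlgebra K G) :
    leadingIdeal gt (relations G b q κ Set.univ) =
      leadingIdeal gt (relations G b q κ (Set.range b)) := by
  apply le_antisymm
  · rw [leadingIdeal, TwoSidedIdeal.span_le]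
    rintro _ ⟨f, hf, m, hm, rfl⟩
    rcases hf with (h | ⟨g, hg, v, -, rfl⟩) | h
    · exact TwoSidedIdeal.subset_span ⟨f, Or.inl (Or.inl h), m, hm, rfl⟩
    · obtain ⟨i, rfl⟩ := exists_eq_of_isLeadingMonomial_tv hgt hpres b hg hm
      rw [relations_range_eq]
      refine TwoSidedIdeal.subset_span ⟨quadRel (reduction b q κ) (Sum.inr ⟨g, hg⟩) (Sum.inl i),
        ⟨Sum.inr ⟨g, hg⟩, Sum.inl i, trivial, rfl⟩, _, ?_, rfl⟩
      rw [tWord_of_ne_one hg]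
      exact isLeadingMonomial_quadRel hgt (decreasing_reduction hgt hpres b q κ)
        (x := Sum.inr ⟨g, hg⟩) (y := Sum.inl i) trivial
    · exact TwoSidedIdeal.subset_span ⟨f, Or.inr h, m, hm, rfl⟩
  · apply TwoSidedIdeal.span_mono
    rintro _ ⟨f, hf, m, hm, rfl⟩
    refine ⟨f, ?_, m, hm, rfl⟩
    rcases hf with (h | ⟨g, hg, v, -, rfl⟩) | h
    · exact Or.inl (Or.inl h)
    · exact Or.inl (Or.inr ⟨g, hg, v, trivial, rfl⟩)
    · exact Or.inr h

theorem isGroebnerBasis_relations_univ_iff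
    {gt : FreeMonoid (Alphabet n G) → FreeMonoid (Alphabet n G) → Prop}
    (hgt : IsMonomialOrder gt) (hpres : PreservesRewriting G gt)
    (b : Module.Basis (Fin n) K V) (q : Fin n → Fin n → K)
    (κ : Fin n → Fin n → MonoidAlgebra K G) :
    IsGroebnerBasis gt (relations G b q κ Set.univ)
        (TwoSidedIdeal.span (relations G b q κ Set.univ)) ↔
      IsGroebnerBasis gt (relations G b q κ (Set.range b))
        (TwoSidedIdeal.span (relations G b q κ (Set.range b))) := by
  rw [IsGroebnerBasis, IsGroebnerBasis, leadingIdeal_relations_univ hgt hpres,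
    span_relations_univ, and_iff_right TwoSidedIdeal.subset_span, and_iff_right]
  rw [← span_relations_univ]
  exact TwoSidedIdeal.subset_span

/-! ### Bilinear normal forms of products of two vectors -/

/-- The bilinear map sending `(v_l, v_k)` to the normal form of `v_l v_k` in the quantum polynomial
algebra. -/
def quantumNormal (b : Module.Basis (Fin n) K V) (G : Subgroup (LinearMap.GeneralLinearGroup K V))
    (q : Fin n → Fin n → K) : V →ₗ[K] V →ₗ[K] FreeAssoc K (Alphabet n G) :=
  b.constr K fun l => b.constr K fun k =>
    if k < l then q k l • MonoidAlgebra.of K _ (vWord G k * vWord G l)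
    else MonoidAlgebra.of K _ (vWord G l * vWord G k)

/-- The bilinear map sending `(v_l, v_k)` to `κ(v_k, v_l)` if `k < l` and to zero otherwise. -/
def upperKappa (b : Module.Basis (Fin n) K V) (κ : Fin n → Fin n → MonoidAlgebra K G) :
    V →ₗ[K] V →ₗ[K] MonoidAlgebra K G :=
  b.constr K fun l => b.constr K fun k => if k < l then κ k l else 0

variable (b : Module.Basis (Fin n) K V) (q : Fin n → Fin n → K)
  (κ : Fin n → Fin n → MonoidAlgebra K G)

theorem quantumNormal_basis (l k : Fin n) : quantumNormal b G q (b l) (b k) =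
    if k < l then q k l • MonoidAlgebra.of K _ (vWord G k * vWord G l)
    else MonoidAlgebra.of K _ (vWord G l * vWord G k) := by
  rw [quantumNormal, Module.Basis.constr_basis, Module.Basis.constr_basis]

theorem upperKappa_basis (l k : Fin n) :
    upperKappa b κ (b l) (b k) = if k < l then κ k l else 0 := by
  rw [upperKappa, Module.Basis.constr_basis, Module.Basis.constr_basis]

/-- Two bilinear expressions on `V` agree modulo a submodule if they agree on basis vectors. -/
theorem smodEq_of_basis {M : Type*} [AddCommGroup M] [Module K M] {U : Submodule K M}
    {B B' : V →ₗ[K] V →ₗ[K] M} (h : ∀ l k, B (b l) (b k) ≡ B' (b l) (b k) [SMOD U]) (u v : V) :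
    B u v ≡ B' u v [SMOD U] := by
  have hB : B.compr₂ U.mkQ = B'.compr₂ U.mkQ :=
    b.ext fun l => b.ext fun k => h l k
  exact LinearMap.congr_fun₂ hB u v

theorem quantumNormal_mem_suppOn (u v : V) : quantumNormal b G q u v ∈
    suppOn K fun w => ∃ i j, i ≤ j ∧ w = vWord G i * vWord G j := by
  rw [← SModEq.zero]
  refine smodEq_of_basis b (B' := 0) (fun l k => ?_) u v
  rw [LinearMap.zero_apply, LinearMap.zero_apply, SModEq.zero, quantumNormal_basis]
  split_ifs with h
  · exact Submodule.smul_mem _ _ (of_mem_suppOn ⟨k, l, h.le, rfl⟩)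
  · exact of_mem_suppOn ⟨l, k, not_lt.1 h, rfl⟩

/-! ### Rewriting modulo multiples of relations -/

section Rewriting

variable {p p' r : FreeMonoid (Alphabet n G) → Prop} {f f' : FreeAssoc K (Alphabet n G)}

theorem one_mem_suppOn {X : Type*} : (1 : FreeAssoc K X) ∈ suppOn K (· = 1) := by
  rw [← map_one (MonoidAlgebra.of K _)]
  exact of_mem_suppOn rfl

/-- The predicate `r` bounds the top words of the multiples used. No bound is needed if g or h is 1,
since t_1 = 1 makes both sides equal. The rules below follow the same pattern. -/
theorem smodEq_tt (hf : f ∈ suppOn K p) (hf' : f' ∈ suppOn K p') {g h : G}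
    (H : g ≠ 1 → h ≠ 1 → ∀ a c, p a → p' c → r (a * (tWord n g * tWord n h) * c)) :
    f * (tElem n g * tElem n h) * f' ≡ f * tElem n (g * h) * f'
      [SMOD genSpan Reducible (reduction b q κ) r] := by
  by_cases hg : g = 1
  · subst hg
    rw [tElem_one, one_mul, one_mul]
    exact SModEq.rfl
  by_cases hh : h = 1
  · subst hh
    rw [tElem_one, mul_one, mul_one]
    exact SModEq.rfl
  have := mul_quadRel_mul_mem_genSpan (r := r) (P := Reducible) (red := reduction b q κ)
    (x := Sum.inr ⟨g, hg⟩) (y := Sum.inr ⟨h, hh⟩) trivial hf hf' (fun a c ha hc => by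
      rw [← tWord_of_ne_one, ← tWord_of_ne_one]
      exact H hg hh a c ha hc)
  rw [SModEq.sub_mem]
  rwa [quadRel, ← tWord_of_ne_one, ← tWord_of_ne_one, map_mul, mul_sub, sub_mul] at this

theorem smodEq_tv_basis (hf : f ∈ suppOn K p) (hf' : f' ∈ suppOn K p') {g : G} (i : Fin n)
    (H : g ≠ 1 → ∀ a c, p a → p' c → r (a * (tWord n g * vWord G i) * c)) :
    f * (tElem n g * vecElem b G (b i)) * f' ≡
      f * (vecElem b G (act g (b i)) * tElem n g) * f'
      [SMOD genSpan Reducible (reduction b q κ) r] := by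
  by_cases hg : g = 1
  · subst hg
    rw [tElem_one, one_mul, mul_one]
    rfl
  have := mul_quadRel_mul_mem_genSpan (r := r) (P := Reducible) (red := reduction b q κ)
    (x := Sum.inr ⟨g, hg⟩) (y := Sum.inl i) trivial hf hf' (fun a c ha hc => by
      rw [← tWord_of_ne_one]
      exact H hg a c ha hc)
  rw [SModEq.sub_mem, vecElem_basis]
  rwa [quadRel, ← tWord_of_ne_one, map_mul, mul_sub, sub_mul] at this

theorem smodEq_tv (hf : f ∈ suppOn K p) (hf' : f' ∈ suppOn K p') {g : G} (v : V)
    (H : g ≠ 1 → ∀ i a c, p a → p' c → r (a * (tWord n g * vWord G i) * c)) :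
    f * (tElem n g * vecElem b G v) * f' ≡ f * (vecElem b G (act g v) * tElem n g) * f'
      [SMOD genSpan Reducible (reduction b q κ) r] := by
  have hv := b.mem_span v
  induction hv using Submodule.span_induction with
  | mem _ h =>
    obtain ⟨i, rfl⟩ := h
    exact smodEq_tv_basis b q κ hf hf' i fun hg => H hg i
  | zero => simp
  | add u v _ _ hu hv => simpa only [map_add, mul_add, add_mul] using hu.add hv
  | smul c v _ hv => simpa only [map_smul, mul_smul_comm, smul_mul_assoc] using hv.smul c

theorem smodEq_vv_basis (hf : f ∈ suppOn K p) (hf' : f' ∈ suppOn K p') {k l : Fin n} (hkl : k < l)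
    (H : ∀ a c, p a → p' c → r (a * (vWord G l * vWord G k) * c)) :
    f * (vecElem b G (b l) * vecElem b G (b k)) * f' ≡
      f * (q k l • (vecElem b G (b k) * vecElem b G (b l)) + groupAlgLin n G (κ k l)) * f'
      [SMOD genSpan Reducible (reduction b q κ) r] := by
  have := mul_quadRel_mul_mem_genSpan (r := r) (P := Reducible) (red := reduction b q κ)
    (x := Sum.inl l) (y := Sum.inl k) hkl hf hf' H
  rw [SModEq.sub_mem]
  rw [quadRel, mul_sub, sub_mul, reduction, map_mul, map_mul] at this
  simp only [vecElem_basis]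
  exact this

/-- Both sides are bilinear in u and v, so the check is on basis vectors: a pair in decreasing index
order is rewritten once, any other pair is already normal. -/
theorem smodEq_vv (hf : f ∈ suppOn K p) (hf' : f' ∈ suppOn K p') (u v : V)
    (H : ∀ k l a c, p a → p' c → r (a * (vWord G l * vWord G k) * c)) :
    f * (vecElem b G u * vecElem b G v) * f' ≡
      f * (quantumNormal b G q u v + groupAlgLin n G (upperKappa b κ u v)) * f'
      [SMOD genSpan Reducible (reduction b q κ) r] := by
  let M : FreeAssoc K (Alphabet n G) →ₗ[K] FreeAssoc K (Alphabet n G) :=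
    LinearMap.mulRight K f' ∘ₗ LinearMap.mulLeft K f
  refine smodEq_of_basis b
    (B := ((LinearMap.mul K _).compl₁₂ (vecElem b G) (vecElem b G)).compr₂ M)
    (B' := (quantumNormal b G q + (upperKappa b κ).compr₂ (groupAlgLin n G)).compr₂ M)
    (fun l k => ?_) u v
  change f * (vecElem b G (b l) * vecElem b G (b k)) * f' ≡
      f * (quantumNormal b G q (b l) (b k) + groupAlgLin n G (upperKappa b κ (b l) (b k))) * f'
      [SMOD genSpan Reducible (reduction b q κ) r]
  rw [quantumNormal_basis, upperKappa_basis]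
  split_ifs with h
  · have := smodEq_vv_basis b q κ (r := r) hf hf' h (H k l)
    rwa [vecElem_basis b k, vecElem_basis b l, ← map_mul, ← map_mul, map_mul _ (vWord G l),
      ← vecElem_basis b l, ← vecElem_basis b k] at this
  · rw [map_zero, add_zero, vecElem_basis, vecElem_basis, ← map_mul]
    exact SModEq.rfl

theorem smodEq_groupAlg_t (x : MonoidAlgebra K G) {g : G}
    (H : ∀ h : G, h ≠ 1 → g ≠ 1 → r (tWord n h * tWord n g)) :
    groupAlgLin n G x * tElem n g ≡ groupAlgLin n G (x * MonoidAlgebra.single g 1)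
      [SMOD genSpan Reducible (reduction b q κ) r] := by
  induction x using MonoidAlgebra.induction_linear with
  | zero => simp
  | add x y hx hy => simpa only [map_add, add_mul] using hx.add hy
  | single h c =>
    have := smodEq_tt b q κ (r := r) (g := h) (h := g) (one_mem_suppOn (K := K))
      (one_mem_suppOn (K := K)) (by rintro hh hg _ _ rfl rfl; simpa using H h hh hg)
    rw [one_mul, one_mul, mul_one, mul_one] at this
    rw [MonoidAlgebra.single_mul_single, groupAlgLin_single, groupAlgLin_single, mul_one,
      smul_mul_assoc]
    exact this.smul c

theorem smodEq_t_groupAlg (x : MonoidAlgebra K G) {g : G}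
    (H : ∀ h : G, g ≠ 1 → h ≠ 1 → r (tWord n g * tWord n h)) :
    tElem n g * groupAlgLin n G x ≡ groupAlgLin n G (MonoidAlgebra.single g 1 * x)
      [SMOD genSpan Reducible (reduction b q κ) r] := by
  induction x using MonoidAlgebra.induction_linear with
  | zero => simp
  | add x y hx hy => simpa only [map_add, mul_add] using hx.add hy
  | single h c =>
    have := smodEq_tt b q κ (r := r) (g := g) (h := h) (one_mem_suppOn (K := K))
      (one_mem_suppOn (K := K)) (by rintro hg hh _ _ rfl rfl; simpa using H h hg hh)
    rw [one_mul, one_mul, mul_one, mul_one] at this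
    rw [MonoidAlgebra.single_mul_single, groupAlgLin_single, groupAlgLin_single, one_mul,
      mul_smul_comm]
    exact this.smul c

/-- The element `∑ u_h t_h` of the free algebra. -/
def vecGroupElem [Fintype G] (b : Module.Basis (Fin n) K V) (u : G → V) :
    FreeAssoc K (Alphabet n G) :=
  ∑ h, vecElem b G (u h) * tElem n h

theorem smodEq_groupAlg_v [Fintype G] (x : MonoidAlgebra K G) (i : Fin n)
    (H : ∀ h : G, h ≠ 1 → r (tWord n h * vWord G i)) :
    groupAlgLin n G x * vecElem b G (b i) ≡ vecGroupElem b (fun h => x.coeff h • act h (b i))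
      [SMOD genSpan Reducible (reduction b q κ) r] := by
  rw [groupAlgLin_eq_sum, Finset.sum_mul]
  refine SModEq.sum fun h _ => ?_
  have := smodEq_tv_basis b q κ (r := r) (g := h) (one_mem_suppOn (K := K))
    (one_mem_suppOn (K := K)) i (by rintro hh _ _ rfl rfl; simpa using H h hh)
  rw [one_mul, one_mul, mul_one, mul_one] at this
  rw [map_smul, smul_mul_assoc, smul_mul_assoc]
  exact this.smul _

theorem vecGroupElem_add [Fintype G] (u u' : G → V) :
    vecGroupElem b (u + u') = vecGroupElem b u + vecGroupElem b u' := by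
  simp [vecGroupElem, add_mul, Finset.sum_add_distrib]

theorem vecGroupElem_smul [Fintype G] (c : K) (u : G → V) :
    vecGroupElem b (c • u) = c • vecGroupElem b u := by
  simp [vecGroupElem, Finset.smul_sum]

theorem v_mul_groupAlg [Fintype G] (x : MonoidAlgebra K G) (v : V) :
    vecElem b G v * groupAlgLin n G x = vecGroupElem b (fun h => x.coeff h • v) := by
  rw [groupAlgLin_eq_sum, Finset.mul_sum]
  refine Finset.sum_congr rfl fun h _ => ?_
  rw [map_smul, smul_mul_assoc, mul_smul_comm]

end Rewriting

/-! ### Resolving the four kinds of overlaps -/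

/-- The obstruction to resolving the overlap `t_g v_j v_i`, quantum polynomial part. -/
def quantumObstruction (g : G) (i j : Fin n) : FreeAssoc K (Alphabet n G) :=
  quantumNormal b G q (act g (b j)) (act g (b i)) -
    q i j • quantumNormal b G q (act g (b i)) (act g (b j))

/-- The obstruction to resolving the overlap `t_g v_j v_i`, group algebra part. -/
def kappaObstruction (g : G) (i j : Fin n) : MonoidAlgebra K G :=
  (upperKappa b κ (act g (b j)) (act g (b i)) -
    q i j • upperKappa b κ (act g (b i)) (act g (b j))) * MonoidAlgebra.single g 1 -
    MonoidAlgebra.single g 1 * κ i j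

/-- The coefficient at `t_h` of the obstruction to resolving the overlap `v_k v_j v_i`. -/
def jacobiObstruction (i j k : Fin n) (h : G) : V :=
  (κ i j).coeff h • ((q i k * q j k) • act h (b k) - b k)
    + (κ i k).coeff h • (q j k • b j - q i j • act h (b j))
    + (κ j k).coeff h • (act h (b i) - (q i j * q i k) • b i)

variable {gt : FreeMonoid (Alphabet n G) → FreeMonoid (Alphabet n G) → Prop}

/-- Both routes end at t_{ghk}; the products may be 1. -/
theorem overlap_ttt (hgt : IsMonomialOrder gt) (hpres : PreservesRewriting G gt) {g h k : G}
    (hg : g ≠ 1) (hh : h ≠ 1) (hk : k ≠ 1) :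
    tElem n (g * h) * tElem n k - tElem n g * tElem n (h * k) ∈
      genSpan Reducible (reduction b q κ) (gt (tWord n g * tWord n h * tWord n k)) := by
  have h1 := smodEq_tt b q κ (r := gt (tWord n g * tWord n h * tWord n k)) (g := g * h) (h := k)
    (one_mem_suppOn (K := K)) (one_mem_suppOn (K := K)) (by
      rintro - - _ _ rfl rfl
      simpa using hgt.mul_right (hpres.tt_gt_t g h hg hh) (tWord n k))
  have h2 := smodEq_tt b q κ (r := gt (tWord n g * tWord n h * tWord n k)) (g := g) (h := h * k)
    (one_mem_suppOn (K := K)) (one_mem_suppOn (K := K)) (by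
      rintro - - _ _ rfl rfl
      simpa [mul_assoc] using hgt.mul_left (tWord n g) (hpres.tt_gt_t h k hh hk))
  rw [one_mul, one_mul, mul_one, mul_one] at h1 h2
  rw [← SModEq.sub_mem]
  rw [← mul_assoc] at h2
  exact h1.trans h2.symm

/-- Both routes end at (gh)(v_i) t_{gh}, because G acts on V. -/
theorem overlap_ttv (hgt : IsMonomialOrder gt) (hpres : PreservesRewriting G gt) {g h : G}
    (hg : g ≠ 1) (hh : h ≠ 1) (i : Fin n) :
    tElem n (g * h) * vecElem b G (b i) - tElem n g * (vecElem b G (act h (b i)) * tElem n h) ∈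
      genSpan Reducible (reduction b q κ) (gt (tWord n g * tWord n h * vWord G i)) := by
  set w := tWord n g * tWord n h * vWord G i with hw
  have h1 := smodEq_tv_basis b q κ (r := gt w) (g := g * h) (one_mem_suppOn (K := K))
    (one_mem_suppOn (K := K)) i (by
      rintro - _ _ rfl rfl
      simpa using hgt.mul_right (hpres.tt_gt_t g h hg hh) (vWord G i))
  have o2 : ∀ l, gt w (tWord n g * vWord G l * tWord n h) := fun l => by
    simpa [hw, mul_assoc] using hgt.mul_left (tWord n g) (hpres.tv_gt_vt i l h hh)
  have h2 := smodEq_tv b q κ (r := gt w) (g := g) (one_mem_suppOn (K := K))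
    (tElem_mem_suppOn (K := K) h) (act h (b i)) (by
      rintro - l _ _ rfl rfl
      simpa using o2 l)
  have h3 := smodEq_tt b q κ (r := gt w) (g := g) (h := h)
    (vecElem_mem_suppOn b (act g (act h (b i)))) (one_mem_suppOn (K := K)) (by
      rintro - - _ _ ⟨l, rfl⟩ rfl
      have := hgt.trans _ _ _ (o2 l) (hgt.mul_right (hpres.tv_gt_vt l l g hg) (tWord n h))
      simpa [mul_assoc] using this)
  simp only [one_mul, mul_one, mul_assoc] at h1 h2 h3
  rw [← SModEq.sub_mem]
  exact h1.trans (h2.trans h3).symm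

/-- One route gives g(v_j) g(v_i) t_g, the other q_{ij} g(v_i) g(v_j) t_g + t_g κ(v_i, v_j). Putting
the products of vectors into normal form splits the difference into a quadratic part and a group
algebra part. -/
theorem overlap_tvv (hgt : IsMonomialOrder gt) (hpres : PreservesRewriting G gt) {g : G}
    (hg : g ≠ 1) {i j : Fin n} (hij : i < j) :
    vecElem b G (act g (b j)) * tElem n g * vecElem b G (b i) -
      tElem n g * (q i j • (vecElem b G (b i) * vecElem b G (b j)) + groupAlgLin n G (κ i j)) ≡
    quantumObstruction b q g i j * tElem n g + groupAlgLin n G (kappaObstruction b q κ g i j)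
      [SMOD genSpan Reducible (reduction b q κ) (gt (tWord n g * vWord G j * vWord G i))] := by
  set w := tWord n g * vWord G j * vWord G i with hw
  -- These bounds record that every word rewritten along either route is below `w`.
  have o1 : ∀ l, gt w (vWord G l * tWord n g * vWord G i) := fun l =>
    hgt.mul_right (hpres.tv_gt_vt j l g hg) _
  have o2 : ∀ l k, gt w (vWord G l * vWord G k * tWord n g) := fun l k => by
    have := hgt.mul_left (vWord G l) (hpres.tv_gt_vt i k g hg)
    rw [← mul_assoc, ← mul_assoc] at this
    exact hgt.trans _ _ _ (o1 l) this
  have o3 : gt w (tWord n g * vWord G i * vWord G j) := by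
    simpa [hw, mul_assoc] using hgt.mul_left (tWord n g) (hpres.vv_gt_vv i j hij)
  have o4 : ∀ h, gt w (tWord n h * tWord n g) := fun h =>
    hgt.trans _ _ _ (o2 j i) (hgt.mul_right (hpres.vv_gt_tWord hgt i j h) _)
  have o5 : ∀ h, gt w (tWord n g * tWord n h) := fun h => by
    simpa [hw, mul_assoc] using hgt.mul_left (tWord n g) (hpres.vv_gt_tWord hgt i j h)
  have o6 : ∀ l, gt w (vWord G l * tWord n g * vWord G j) := fun l =>
    hgt.trans _ _ _ o3 (hgt.mul_right (hpres.tv_gt_vt i l g hg) _)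
  have quad : ∀ u v : V, vecElem b G u * vecElem b G v * tElem n g ≡
      quantumNormal b G q u v * tElem n g +
        groupAlgLin n G (upperKappa b κ u v * MonoidAlgebra.single g 1)
      [SMOD genSpan Reducible (reduction b q κ) (gt w)] := by
    intro u v
    have h1 := smodEq_vv b q κ (r := gt w) (one_mem_suppOn (K := K))
      (tElem_mem_suppOn (K := K) g) u v (by
        rintro k l _ _ rfl rfl
        simpa using o2 l k)
    rw [one_mul, one_mul, add_mul] at h1
    exact h1.trans (SModEq.rfl.add (smodEq_groupAlg_t b q κ _ fun h _ _ => o4 h))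
  have h1 := smodEq_tv_basis b q κ (r := gt w) (g := g) (vecElem_mem_suppOn b (act g (b j)))
    (one_mem_suppOn (K := K)) i (by
      rintro - _ _ ⟨l, rfl⟩ rfl
      simpa [mul_assoc] using o1 l)
  have h2 := smodEq_tv_basis b q κ (r := gt w) (g := g) (one_mem_suppOn (K := K))
    (f' := vecElem b G (b j)) (p' := (· = vWord G j)) (by
      rw [vecElem_basis]
      exact of_mem_suppOn rfl) i (by
      rintro - _ _ rfl rfl
      simpa using o3)
  have h3 := smodEq_tv_basis b q κ (r := gt w) (g := g) (vecElem_mem_suppOn b (act g (b i)))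
    (one_mem_suppOn (K := K)) j (by
      rintro - _ _ ⟨l, rfl⟩ rfl
      simpa [mul_assoc] using o6 l)
  have h4 := smodEq_t_groupAlg b q κ (r := gt w) (g := g) (κ i j) fun h _ _ => o5 h
  simp only [one_mul, mul_one, mul_assoc] at h1 h2 h3
  have q1 := quad (act g (b j)) (act g (b i))
  have q2 := quad (act g (b i)) (act g (b j))
  simp only [mul_assoc] at q1 q2
  have h5 := (h1.trans q1).sub ((((h2.trans h3).trans q2).smul (q i j)).add h4)
  convert h5 using 1
  · simp only [mul_assoc, mul_add, mul_smul_comm]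
  · simp only [quantumObstruction, kappaObstruction, sub_mul, map_sub, smul_add, smul_mul_assoc,
      map_smul]
    abel

/-- Both routes end at q_{ij} q_{ik} q_{jk} v_i v_j v_k, which cancels. What remains are the κ terms
shed on the way, with each t_h v moved to h(v) t_h. -/
theorem overlap_vvv [Fintype G] (hgt : IsMonomialOrder gt) (hpres : PreservesRewriting G gt)
    {i j k : Fin n} (hij : i < j) (hjk : j < k) :
    (q j k • (vecElem b G (b j) * vecElem b G (b k)) + groupAlgLin n G (κ j k)) *
        vecElem b G (b i) -
      vecElem b G (b k) *
        (q i j • (vecElem b G (b i) * vecElem b G (b j)) + groupAlgLin n G (κ i j)) ≡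
    vecGroupElem b (jacobiObstruction b q κ i j k)
      [SMOD genSpan Reducible (reduction b q κ) (gt (vWord G k * vWord G j * vWord G i))] := by
  set w := vWord G k * vWord G j * vWord G i with hw
  have hik := hij.trans hjk
  have mem : ∀ l, vecElem b G (b l) ∈ suppOn K (· = vWord G l) := fun l => by
    rw [vecElem_basis]
    exact of_mem_suppOn rfl
  have o1 : gt w (vWord G j * vWord G k * vWord G i) := hgt.mul_right (hpres.vv_gt_vv j k hjk) _
  have o2 : gt w (vWord G j * vWord G i * vWord G k) := by
    have := hgt.mul_left (vWord G j) (hpres.vv_gt_vv i k hik)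
    rw [← mul_assoc, ← mul_assoc] at this
    exact hgt.trans _ _ _ o1 this
  have o3 : gt w (vWord G k * vWord G i * vWord G j) := by
    simpa [hw, mul_assoc] using hgt.mul_left (vWord G k) (hpres.vv_gt_vv i j hij)
  have o4 : gt w (vWord G i * vWord G k * vWord G j) :=
    hgt.trans _ _ _ o3 (hgt.mul_right (hpres.vv_gt_vv i k hik) _)
  have o5 : ∀ h, gt w (tWord n h * vWord G i) := fun h =>
    hgt.mul_right (hpres.vv_gt_tWord hgt j k h) _
  have o6 : ∀ h, gt w (tWord n h * vWord G j) := fun h =>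
    hgt.trans _ _ _ o3 (hgt.mul_right (hpres.vv_gt_tWord hgt i k h) _)
  have o7 : ∀ h, gt w (tWord n h * vWord G k) := fun h =>
    hgt.trans _ _ _ o2 (hgt.mul_right (hpres.vv_gt_tWord hgt i j h) _)
  -- Routes: v_j v_k v_i → v_j v_i v_k → v_i v_j v_k by `a1`, `a2`, and v_k v_i v_j → v_i v_k v_j →
  -- v_i v_j v_k by `a3`, `a4`.
  have a1 := smodEq_vv_basis b q κ (r := gt w) (mem j) (one_mem_suppOn (K := K)) hik (by
    rintro _ _ rfl rfl
    simpa [mul_assoc] using o1)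
  have a2 := smodEq_vv_basis b q κ (r := gt w) (one_mem_suppOn (K := K)) (mem k) hij (by
    rintro _ _ rfl rfl
    simpa using o2)
  have a3 := smodEq_vv_basis b q κ (r := gt w) (one_mem_suppOn (K := K)) (mem j) hik (by
    rintro _ _ rfl rfl
    simpa using o3)
  have a4 := smodEq_vv_basis b q κ (r := gt w) (mem i) (one_mem_suppOn (K := K)) hjk (by
    rintro _ _ rfl rfl
    simpa [mul_assoc] using o4)
  have b1 := smodEq_groupAlg_v b q κ (r := gt w) (κ j k) i fun h _ => o5 h
  have b2 := smodEq_groupAlg_v b q κ (r := gt w) (κ i k) j fun h _ => o6 h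
  have b3 := smodEq_groupAlg_v b q κ (r := gt w) (κ i j) k fun h _ => o7 h
  have c1 := v_mul_groupAlg b (κ i j) (b k)
  have c2 := v_mul_groupAlg b (κ i k) (b j)
  have c3 := v_mul_groupAlg b (κ j k) (b i)
  have hJ : jacobiObstruction b q κ i j k =
      (q i k * q j k) • (fun h : G => (κ i j).coeff h • act h (b k)) +
      (-1 : K) • (fun h : G => (κ i j).coeff h • b k) +
      q j k • (fun h : G => (κ i k).coeff h • b j) +
      (-q i j) • (fun h : G => (κ i k).coeff h • act h (b j)) +
      (fun h : G => (κ j k).coeff h • act h (b i)) +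
      (-(q i j * q i k)) • (fun h : G => (κ j k).coeff h • b i) := by
    funext h
    simp only [jacobiObstruction, Pi.add_apply, Pi.smul_apply]
    module
  rw [hJ]
  simp only [vecGroupElem_add, vecGroupElem_smul, ← c1, ← c2, ← c3]
  simp only [SModEq.def, Submodule.Quotient.mk_add, Submodule.Quotient.mk_sub,
    Submodule.Quotient.mk_smul, one_mul, mul_one, mul_assoc, mul_add, add_mul, mul_smul_comm,
    smul_mul_assoc] at a1 a2 a3 a4 b1 b2 b3 ⊢
  rw [← b1, ← b2, ← b3, a1, a2, a3, a4]
  module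

/-! ### Vanishing of the obstructions -/

/-- The projection of the free algebra onto the quantum polynomial algebra sending `t_g` to `1`. -/
def toQuantumPoly (G : Subgroup (LinearMap.GeneralLinearGroup K V)) (q : Fin n → Fin n → K) :
    FreeAssoc K (Alphabet n G) →ₐ[K] QuantumPoly q :=
  MonoidAlgebra.lift K _ _ (FreeMonoid.lift
    (Sum.elim (fun i => RingQuot.mkAlgHom K (QuantumRel q) (FreeAlgebra.ι K i)) fun _ => 1))

theorem toQuantumPoly_vWord (i : Fin n) :
    toQuantumPoly G q (MonoidAlgebra.of K _ (vWord G i)) = quantumVec b q (b i) := by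
  rw [toQuantumPoly, MonoidAlgebra.lift_of, vWord, FreeMonoid.lift_eval_of, quantumVec,
    Module.Basis.constr_basis]
  rfl

theorem toQuantumPoly_tElem (g : G) : toQuantumPoly G q (tElem n g) = 1 := by
  rw [toQuantumPoly, tElem, MonoidAlgebra.lift_of]
  by_cases hg : g = 1
  · rw [hg, tWord_one, map_one]
  · rw [tWord_of_ne_one hg, FreeMonoid.lift_eval_of]
    rfl

theorem quantumVec_mul_quantumVec {i j : Fin n} (hij : i < j) :
    quantumVec b q (b j) * quantumVec b q (b i) =
      q i j • (quantumVec b q (b i) * quantumVec b q (b j)) := by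
  simp only [quantumVec, Module.Basis.constr_basis, ← map_mul, ← map_smul]
  exact RingQuot.mkAlgHom_rel K (QuantumRel.swap i j hij)

theorem toQuantumPoly_quantumNormal (u v : V) :
    toQuantumPoly G q (quantumNormal b G q u v) = quantumVec b q u * quantumVec b q v := by
  have : (quantumNormal b G q).compr₂ (toQuantumPoly G q).toLinearMap =
      (LinearMap.mul K _).compl₁₂ (quantumVec b q) (quantumVec b q) := by
    refine b.ext fun l => b.ext fun k => ?_
    change toQuantumPoly G q (quantumNormal b G q (b l) (b k)) =
      quantumVec b q (b l) * quantumVec b q (b k)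
    rw [quantumNormal_basis]
    split_ifs with h
    · rw [map_smul, map_mul, map_mul, toQuantumPoly_vWord b, toQuantumPoly_vWord b,
        quantumVec_mul_quantumVec b q h]
    · rw [map_mul, map_mul, toQuantumPoly_vWord b, toQuantumPoly_vWord b]
  exact LinearMap.congr_fun₂ this u v

/-- The action of `v_l` on the truncation of the quantum polynomial algebra in degrees at most two,
with degree two spanned by normal words. -/
def truncatedAction (b : Module.Basis (Fin n) K V)
    (G : Subgroup (LinearMap.GeneralLinearGroup K V)) (q : Fin n → Fin n → K) :
    V →ₗ[K] Module.End K (K × V × FreeAssoc K (Alphabet n G)) where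
  toFun u :=
    { toFun := fun x => (0, x.1 • u, quantumNormal b G q u x.2.1)
      map_add' := fun x y => by simp [add_smul]
      map_smul' := fun c x => by simp [mul_smul] }
  map_add' u v := by ext <;> simp
  map_smul' c u := by ext <;> simp

/-- The action of the quantum polynomial algebra on its truncation. -/
def quantumPolyAction (b : Module.Basis (Fin n) K V)
    (G : Subgroup (LinearMap.GeneralLinearGroup K V)) (q : Fin n → Fin n → K) :
    QuantumPoly q →ₐ[K] Module.End K (K × V × FreeAssoc K (Alphabet n G)) :=
  RingQuot.liftAlgHom K ⟨FreeAlgebra.lift K fun i => truncatedAction b G q (b i), by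
    -- A product of two generators acts nontrivially only from degree zero to degree two, where v_j
    -- v_i has normal form q_{ij} v_i v_j.
    rintro _ _ ⟨i, j, hij⟩
    refine LinearMap.ext fun x => ?_
    simp only [map_mul, map_smul, FreeAlgebra.lift_ι_apply, Module.End.mul_apply,
      LinearMap.smul_apply, truncatedAction, LinearMap.coe_mk, AddHom.coe_mk,
      quantumNormal_basis, hij, hij.not_gt, if_true, if_false, zero_smul, Prod.smul_mk, smul_zero]
    rw [smul_comm]⟩

theorem quantumPolyAction_quantumVec (u : V) :
    quantumPolyAction b G q (quantumVec b q u) = truncatedAction b G q u := by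
  have : (quantumPolyAction b G q).toLinearMap ∘ₗ quantumVec b q = truncatedAction b G q := by
    refine b.ext fun i => ?_
    change quantumPolyAction b G q (quantumVec b q (b i)) = _
    rw [quantumVec, Module.Basis.constr_basis, quantumPolyAction, RingQuot.liftAlgHom_mkAlgHom_apply,
      FreeAlgebra.lift_ι_apply]
  exact LinearMap.congr_fun this u

/-- Acting on 1 recovers the normal form of a product, so equal quadratic elements of K_Q[V] have
equal normal forms. The truncation avoids any basis theorem for the whole algebra. -/
theorem quantumPolyAction_mul (u v : V) :
    (quantumPolyAction b G q (quantumVec b q u * quantumVec b q v) (1, 0, 0)).2.2 =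
      quantumNormal b G q u v := by
  rw [map_mul, quantumPolyAction_quantumVec, quantumPolyAction_quantumVec]
  simp [truncatedAction]

theorem quantumObstruction_eq_zero_iff (g : G) (i j : Fin n) :
    quantumObstruction b q g i j = 0 ↔
      quantumVec b q (act g (b j)) * quantumVec b q (act g (b i)) =
          q i j • (quantumVec b q (act g (b i)) * quantumVec b q (act g (b j))) := by
  rw [quantumObstruction, sub_eq_zero]
  constructor
  · intro h
    have := congrArg (toQuantumPoly G q) h
    rwa [map_smul, toQuantumPoly_quantumNormal, toQuantumPoly_quantumNormal] at this
  · intro h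
    rw [← quantumPolyAction_mul, ← quantumPolyAction_mul, h, map_smul]
    rfl

/-- The projection of the free algebra onto the group algebra sending `v_i` to `0`. -/
def toGroupAlg (n : ℕ) (G : Subgroup (LinearMap.GeneralLinearGroup K V)) :
    FreeAssoc K (Alphabet n G) →ₐ[K] MonoidAlgebra K G :=
  MonoidAlgebra.lift K _ _ (FreeMonoid.lift
    (Sum.elim (fun _ => 0) fun g => MonoidAlgebra.single g.1 1))

theorem toGroupAlg_tElem (g : G) : toGroupAlg n G (tElem n g) = MonoidAlgebra.single g 1 := by
  rw [toGroupAlg, tElem, MonoidAlgebra.lift_of]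
  by_cases hg : g = 1
  · rw [hg, tWord_one, map_one, MonoidAlgebra.one_def]
  · rw [tWord_of_ne_one hg, FreeMonoid.lift_eval_of]
    rfl

theorem toGroupAlg_groupAlgLin (x : MonoidAlgebra K G) :
    toGroupAlg n G (groupAlgLin n G x) = x := by
  induction x using MonoidAlgebra.induction_linear with
  | zero => simp
  | add x y hx hy => rw [map_add, map_add, hx, hy]
  | single g c => rw [groupAlgLin_single, map_smul, toGroupAlg_tElem]; simp

theorem toGroupAlg_quantumNormal (u v : V) : toGroupAlg n G (quantumNormal b G q u v) = 0 := by
  have h0 : ∀ i, toGroupAlg n G (MonoidAlgebra.of K _ (vWord G i)) = 0 := fun i => by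
    rw [toGroupAlg, MonoidAlgebra.lift_of, vWord, FreeMonoid.lift_eval_of]
    rfl
  have : (quantumNormal b G q).compr₂ (toGroupAlg n G).toLinearMap = 0 := by
    refine b.ext fun l => b.ext fun k => ?_
    change toGroupAlg n G (quantumNormal b G q (b l) (b k)) = 0
    rw [quantumNormal_basis]
    split_ifs with h <;> simp only [map_smul, map_mul, h0, zero_mul, smul_zero]
  exact LinearMap.congr_fun₂ this u v

/-- Sending each v_i to 0 kills the quadratic part and isolates the κ part. Once that vanishes,
sending each t_g to 1 detects the quadratic part in K_Q[V]. -/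
theorem tvv_obstruction_eq_zero_iff (g : G) (i j : Fin n) :
    quantumObstruction b q g i j * tElem n g + groupAlgLin n G (kappaObstruction b q κ g i j) = 0 ↔
      quantumObstruction b q g i j = 0 ∧ kappaObstruction b q κ g i j = 0 := by
  constructor
  · intro h
    have h1 : kappaObstruction b q κ g i j = 0 := by
      have := congrArg (toGroupAlg n G) h
      rwa [map_add, map_mul, toGroupAlg_groupAlgLin, quantumObstruction, map_sub, map_smul,
        toGroupAlg_quantumNormal, toGroupAlg_quantumNormal, smul_zero, sub_zero, zero_mul, zero_add,
        map_zero] at this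
    refine ⟨?_, h1⟩
    rw [h1, map_zero, add_zero] at h
    have := congrArg (toQuantumPoly G q) h
    rw [map_mul, toQuantumPoly_tElem, mul_one, map_zero, quantumObstruction, map_sub, map_smul,
      toQuantumPoly_quantumNormal, toQuantumPoly_quantumNormal, sub_eq_zero] at this
    exact (quantumObstruction_eq_zero_iff b q g i j).2 this
  · rintro ⟨h1, h2⟩
    rw [h1, h2, zero_mul, map_zero, zero_add]

theorem upperKappa_apply (u v : V) : upperKappa b κ u v =
    ∑ k : Fin n, ∑ l ∈ Finset.Ioi k, (b.repr u l * b.repr v k) • κ k l := by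
  rw [upperKappa, Module.Basis.constr_apply_fintype, LinearMap.sum_apply]
  simp only [LinearMap.smul_apply, Module.Basis.constr_apply_fintype, Finset.smul_sum,
    Module.Basis.equivFun_apply]
  rw [Finset.sum_comm]
  refine Finset.sum_congr rfl fun k _ => ?_
  rw [← Finset.filter_lt_eq_Ioi, Finset.sum_filter]
  refine Finset.sum_congr rfl fun l _ => ?_
  split_ifs <;> simp [mul_smul]

theorem kappaObstruction_eq_zero_iff (h : G) (i j : Fin n) :
    kappaObstruction b q κ h i j = 0 ↔ ∀ g : G, (κ i j).coeff (h⁻¹ * g * h) =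
      ∑ k : Fin n, ∑ l ∈ Finset.Ioi k, quantumMinor b q (act h) i j k l * (κ k l).coeff g := by
  -- Right multiplication by t_h moves the coefficient at g to gh, while the coefficient of t_h
  -- κ(v_i, v_j) at gh is that of κ(v_i, v_j) at h⁻¹gh. Antisymmetrizing the coordinates gives the
  -- quantum minors.
  have hc : ∀ g : G, (kappaObstruction b q κ h i j).coeff (g * h) =
      (∑ k : Fin n, ∑ l ∈ Finset.Ioi k, quantumMinor b q (act h) i j k l * (κ k l).coeff g) -
        (κ i j).coeff (h⁻¹ * g * h) := by
    intro g
    rw [kappaObstruction, MonoidAlgebra.coeff_sub, Finsupp.sub_apply,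
      MonoidAlgebra.coeff_mul_single_apply, MonoidAlgebra.coeff_single_mul_apply, one_mul, mul_one,
      mul_inv_cancel_right, mul_assoc, upperKappa_apply, upperKappa_apply, Finset.smul_sum,
      ← Finset.sum_sub_distrib]
    congr 1
    rw [MonoidAlgebra.coeff_sum, Finsupp.finsetSum_apply]
    refine Finset.sum_congr rfl fun k _ => ?_
    rw [Finset.smul_sum, ← Finset.sum_sub_distrib, MonoidAlgebra.coeff_sum,
      Finsupp.finsetSum_apply]
    refine Finset.sum_congr rfl fun l _ => ?_
    simp only [MonoidAlgebra.coeff_sub, MonoidAlgebra.coeff_smul, Finsupp.sub_apply,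
      Finsupp.smul_apply, smul_eq_mul, quantumMinor]
    ring
  constructor
  · intro h0 g
    have := hc g
    rw [h0, MonoidAlgebra.coeff_zero, Finsupp.zero_apply] at this
    exact (sub_eq_zero.1 this.symm).symm
  · intro h0
    ext x
    have := hc (x * h⁻¹)
    rwa [h0, sub_self, inv_mul_cancel_right] at this

/-- Since t_1 is not a letter, no overlap tests g = 1; the instances of (ii) and (iii) at the
identity hold automatically. -/
theorem quantumObstruction_one {i j : Fin n} (hij : i < j) :
    quantumObstruction b q (1 : G) i j = 0 := by
  change quantumNormal b G q (b j) (b i) - q i j • quantumNormal b G q (b i) (b j) = 0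
  rw [quantumNormal_basis, quantumNormal_basis, if_pos hij, if_neg hij.not_gt, sub_self]

theorem kappaObstruction_one {i j : Fin n} (hij : i < j) :
    kappaObstruction b q κ 1 i j = 0 := by
  change (upperKappa b κ (b j) (b i) - q i j • upperKappa b κ (b i) (b j)) *
    MonoidAlgebra.single 1 1 - MonoidAlgebra.single 1 1 * κ i j = 0
  rw [upperKappa_basis, upperKappa_basis, if_pos hij, if_neg hij.not_gt, smul_zero, sub_zero,
    ← MonoidAlgebra.one_def, one_mul, mul_one, sub_self]

/-- The words v_i t_g are pairwise distinct, so the coefficient at v_i t_g is the i-th coordinate of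
u_g. -/
theorem vecGroupElem_eq_zero_iff [Fintype G] (u : G → V) : vecGroupElem b u = 0 ↔ u = 0 := by
  classical
  constructor
  · intro h
    funext g
    apply b.repr.injective
    ext i
    have h1 : ∀ g', (vecElem b G (u g') * tElem n g').coeff (vWord G i * tWord n g) =
        if g' = g then b.repr (u g) i else 0 := by
      intro g'
      split_ifs with hg
      · subst hg
        rw [tElem, MonoidAlgebra.of_apply, MonoidAlgebra.coeff_mul_single_eq_coeff_mul (vWord G i),
          mul_one, coeff_vecElem]
        simp
      · by_contra hne
        have hmem : vecElem b G (u g') * tElem n g' ∈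
            suppOn K fun w => ∃ k, w = vWord G k * tWord n g' := by
          refine mul_mem_suppOn (vecElem_mem_suppOn b _) (tElem_mem_suppOn g') ?_
          rintro _ _ ⟨k, rfl⟩ rfl
          exact ⟨k, rfl⟩
        obtain ⟨k, hk⟩ := mem_suppOn_iff.1 hmem _ (Finsupp.mem_support_iff.2 hne)
        have hl := congrArg FreeMonoid.toList hk
        by_cases h1 : g = 1 <;> by_cases h2 : g' = 1 <;>
          simp [vWord, tWord, h1, h2] at hl hg
        exact hg hl.2.symm
    have h2 := congrArg (fun f => f.coeff (vWord G i * tWord n g)) h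
    simpa [vecGroupElem, Finsupp.finsetSum_apply, h1] using h2
  · rintro rfl
    simp [vecGroupElem]

/-! ### The main equivalence -/

theorem reduction_vv (i j : Fin n) : reduction b q κ (Sum.inl j) (Sum.inl i) =
    q i j • (vecElem b G (b i) * vecElem b G (b j)) + groupAlgLin n G (κ i j) := by
  rw [reduction, map_mul, vecElem_basis, vecElem_basis, groupAlgElem_eq]

theorem overlap_vvv_reduction [Fintype G] (hgt : IsMonomialOrder gt)
    (hpres : PreservesRewriting G gt) {i j k : Fin n} (hij : i < j) (hjk : j < k) :
    reduction b q κ (Sum.inl k) (Sum.inl j) * MonoidAlgebra.of K _ (FreeMonoid.of (Sum.inl i)) -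
      MonoidAlgebra.of K _ (FreeMonoid.of (Sum.inl k)) * reduction b q κ (Sum.inl j) (Sum.inl i) ≡
    vecGroupElem b (jacobiObstruction b q κ i j k)
      [SMOD genSpan Reducible (reduction b q κ) (gt (vWord G k * vWord G j * vWord G i))] := by
  have := overlap_vvv b q κ hgt hpres hij hjk
  rwa [← reduction_vv, ← reduction_vv, vecElem_basis b i, vecElem_basis b k] at this

theorem overlap_tvv_reduction (hgt : IsMonomialOrder gt) (hpres : PreservesRewriting G gt) {g : G}
    (hg : g ≠ 1) {i j : Fin n} (hij : i < j) :
    reduction b q κ (Sum.inr ⟨g, hg⟩) (Sum.inl j) *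
        MonoidAlgebra.of K _ (FreeMonoid.of (Sum.inl i)) -
      MonoidAlgebra.of K _ (FreeMonoid.of (Sum.inr ⟨g, hg⟩)) *
        reduction b q κ (Sum.inl j) (Sum.inl i) ≡
    quantumObstruction b q g i j * tElem n g + groupAlgLin n G (kappaObstruction b q κ g i j)
      [SMOD genSpan Reducible (reduction b q κ)
        (gt (FreeMonoid.of (Sum.inr ⟨g, hg⟩) * vWord G j * vWord G i))] := by
  have := overlap_tvv b q κ hgt hpres hg hij
  rw [← reduction_vv, vecElem_basis b i] at this
  rw [← tWord_of_ne_one hg]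
  exact this

/-- A pair v t is not reducible, so the overlaps are only vvv, tvv, ttv and ttt. -/
theorem overlapsResolve_reduction [Fintype G] (hgt : IsMonomialOrder gt)
    (hpres : PreservesRewriting G gt)
    (h1 : ∀ i j k : Fin n, i < j → j < k → jacobiObstruction b q κ i j k = 0)
    (h2 : ∀ (g : G) (i j : Fin n), i < j → quantumObstruction b q g i j = 0)
    (h3 : ∀ (g : G) (i j : Fin n), i < j → kappaObstruction b q κ g i j = 0) :
    OverlapsResolve gt Reducible (reduction b q κ) := by
  rintro (k | ⟨g, hg⟩) (j | ⟨h, hh⟩) (i | ⟨g', hg'⟩) hP hP'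
  · have := overlap_vvv_reduction b q κ hgt hpres hP' hP
    rwa [h1 i j k hP' hP, (vecGroupElem_eq_zero_iff b _).2 rfl, SModEq.zero] at this
  · exact hP'.elim
  · exact hP.elim
  · exact hP.elim
  · have := overlap_tvv_reduction b q κ hgt hpres hg hP'
    rwa [(tvv_obstruction_eq_zero_iff b q κ g i j).2 ⟨h2 g i j hP', h3 g i j hP'⟩,
      SModEq.zero] at this
  · exact hP'.elim
  · have := overlap_ttv b q κ hgt hpres hg hh i
    rw [← tWord_of_ne_one, ← tWord_of_ne_one]
    rw [vecElem_basis] at this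
    exact this
  · rw [← tWord_of_ne_one, ← tWord_of_ne_one, ← tWord_of_ne_one]
    exact overlap_ttt b q κ hgt hpres hg hh hg'

theorem vecGroupElem_mem_suppOn_normal [Fintype G] (u : G → V) :
    vecGroupElem b u ∈ suppOn K (Normal Reducible) := by
  refine Submodule.sum_mem _ fun g _ => ?_
  refine mul_mem_suppOn (vecElem_mem_suppOn b _) (tElem_mem_suppOn g) ?_
  rintro _ _ ⟨i, rfl⟩ rfl
  exact normal_v_t i g

theorem tvv_obstruction_mem_suppOn_normal (g : G) (i j : Fin n) :
    quantumObstruction b q g i j * tElem n g + groupAlgLin n G (kappaObstruction b q κ g i j) ∈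
      suppOn K (Normal Reducible) := by
  refine add_mem (mul_mem_suppOn (sub_mem (quantumNormal_mem_suppOn b q _ _)
    (Submodule.smul_mem _ _ (quantumNormal_mem_suppOn b q _ _))) (tElem_mem_suppOn g) ?_)
    (suppOn_mono ?_ (groupAlgLin_mem_suppOn _))
  · rintro _ _ ⟨i, j, hij, rfl⟩ rfl
    exact normal_v_v_t hij g
  · rintro _ ⟨h, rfl⟩
    exact normal_tWord h

/-- The normal form of the obstruction at an overlap vanishes for a Groebner basis. -/
theorem eq_zero_of_overlap (hgt : IsMonomialOrder gt) (hpres : PreservesRewriting G gt)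
    (hGB : IsGroebnerBasis gt (quadRels Reducible (reduction b q κ))
      (TwoSidedIdeal.span (quadRels Reducible (reduction b q κ))))
    {x y z : Alphabet n G} (hxy : Reducible x y) (hyz : Reducible y z)
    {p : FreeMonoid (Alphabet n G) → Prop} {N : FreeAssoc K (Alphabet n G)}
    (hN : N ∈ suppOn K (Normal Reducible))
    (h : reduction b q κ x y * MonoidAlgebra.of K _ (FreeMonoid.of z) -
      MonoidAlgebra.of K _ (FreeMonoid.of x) * reduction b q κ y z ≡ N
      [SMOD genSpan Reducible (reduction b q κ) p]) : N = 0 := by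
  refine eq_zero_of_isGroebnerBasis hgt (decreasing_reduction hgt hpres b q κ) hGB ?_ hN
  -- The overlap expression is in the ideal and is congruent to `N` modulo the ideal, so `N` is in
  -- the ideal too.
  have h1 := genSpan_le_span _ (SModEq.sub_mem.1 h)
  have h2 := overlap_mem_span (red := reduction b q κ) hxy hyz
  simpa using sub_mem h2 h1

theorem isGroebnerBasis_relations_iff [Fintype G] (hgt : IsMonomialOrder gt)
    (hpres : PreservesRewriting G gt) :
    IsGroebnerBasis gt (relations G b q κ (Set.range b))
        (TwoSidedIdeal.span (relations G b q κ (Set.range b))) ↔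
      (∀ i j k : Fin n, i < j → j < k → jacobiObstruction b q κ i j k = 0) ∧
      (∀ (g : G) (i j : Fin n), i < j → quantumObstruction b q g i j = 0) ∧
      (∀ (g : G) (i j : Fin n), i < j → kappaObstruction b q κ g i j = 0) := by
  rw [relations_range_eq]
  constructor
  · intro hGB
    have htvv : ∀ (g : G) (i j : Fin n), i < j →
        quantumObstruction b q g i j = 0 ∧ kappaObstruction b q κ g i j = 0 := by
      intro g i j hij
      by_cases hg : g = 1
      · subst hg
        exact ⟨quantumObstruction_one b q hij, kappaObstruction_one b q κ hij⟩
      · exact (tvv_obstruction_eq_zero_iff b q κ g i j).1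
          (eq_zero_of_overlap b q κ hgt hpres hGB (x := Sum.inr ⟨g, hg⟩) (y := Sum.inl j)
            (z := Sum.inl i) trivial hij (tvv_obstruction_mem_suppOn_normal b q κ g i j)
            (overlap_tvv_reduction b q κ hgt hpres hg hij))
    refine ⟨fun i j k hij hjk => (vecGroupElem_eq_zero_iff b _).1 ?_,
      fun g i j hij => (htvv g i j hij).1, fun g i j hij => (htvv g i j hij).2⟩
    exact eq_zero_of_overlap b q κ hgt hpres hGB (x := Sum.inl k) (y := Sum.inl j)
      (z := Sum.inl i) hjk hij (vecGroupElem_mem_suppOn_normal b _)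
      (overlap_vvv_reduction b q κ hgt hpres hij hjk)
  · rintro ⟨h1, h2, h3⟩
    exact isGroebnerBasis_of_overlapsResolve hgt (decreasing_reduction hgt hpres b q κ)
      (overlapsResolve_reduction b q κ hgt hpres h1 h2 h3)

end DrinfeldRelations

end QDH

end

/-! ### Translation of the vanishing obstructions into conditions (i)–(iii) -/

theorem mainTheorem2 {K V : Type*} [Field K] [AddCommGroup V] [Module K V] {n : ℕ}
    (b : Module.Basis (Fin n) K V)
    (G : Subgroup (LinearMap.GeneralLinearGroup K V)) [Finite G]
    (q : Fin n → Fin n → K) (hq : ∀ i j, q i j ≠ 0)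
    (κ : Fin n → Fin n → MonoidAlgebra K G)
    (gt : FreeMonoid (QDH.Alphabet n G) → FreeMonoid (QDH.Alphabet n G) → Prop)
    (hgt : QDH.IsMonomialOrder gt) (hpres : QDH.PreservesRewriting G gt) :
    let R := QDH.relations G b q κ Set.univ
    let R₀ := QDH.relations G b q κ (Set.range b)
    let conditions : Prop :=
      (∀ (h : G) (i j k : Fin n), i < j → j < k →
        0 = (κ i j).coeff h • ((q i k * q j k) • QDH.act h (b k) - b k)
          + (κ i k).coeff h • (q j k • b j - q i j • QDH.act h (b j))
          + (κ j k).coeff h • (QDH.act h (b i) - (q i j * q i k) • b i)) ∧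
      (∀ (g : G) (i j : Fin n), i < j →
        QDH.quantumVec b q (QDH.act g (b j)) * QDH.quantumVec b q (QDH.act g (b i)) =
          q i j • (QDH.quantumVec b q (QDH.act g (b i)) *
            QDH.quantumVec b q (QDH.act g (b j)))) ∧
      (∀ (g h : G) (i j : Fin n), i < j →
        (κ i j).coeff (h⁻¹ * g * h) =
          ∑ k : Fin n, ∑ l ∈ Finset.Ioi k,
            QDH.quantumMinor b q (QDH.act h) i j k l * (κ k l).coeff g)
    (QDH.IsGroebnerBasis gt R (TwoSidedIdeal.span R) ↔ conditions) ∧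
    (QDH.IsGroebnerBasis gt R₀ (TwoSidedIdeal.span R₀) ↔ conditions) ∧
    (QDH.IsGroebnerBasis gt R₀ (TwoSidedIdeal.span R₀) → QDH.IsReduced gt R₀) := by
  have := Fintype.ofFinite G
  intro R R₀ conditions
  have key : QDH.IsGroebnerBasis gt R₀ (TwoSidedIdeal.span R₀) ↔ conditions := by
    rw [QDH.isGroebnerBasis_relations_iff b q κ hgt hpres]
    refine and_congr ?_ (and_congr ?_ ?_)
    · constructor
      · intro h g i j k hij hjk
        exact (congrFun (h i j k hij hjk) g).symm
      · intro h i j k hij hjk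
        funext g
        exact (h g i j k hij hjk).symm
    · simp only [QDH.quantumObstruction_eq_zero_iff]
    · simp only [QDH.kappaObstruction_eq_zero_iff]
      -- The group element of the overlap is the conjugating one, which condition (iii) quantifies
      -- second.
      exact ⟨fun h g g' i j hij => h g' i j hij g, fun h g' i j hij g => h g g' i j hij⟩
  exact ⟨(QDH.isGroebnerBasis_relations_univ_iff hgt hpres b q κ).trans key, key,
    fun _ => QDH.isReduced_relations hgt hpres b q κ⟩
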